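/- Let $M=\{(q_1,q_2)\in\mathbb{C}^2 : q_1q_2\neq 0,\ q_1\neq \tfrac14\}$ and let $\mathcal{O}$ be either the ring $\mathbb{C}[q_1,q_1^{-1},q_2,q_2^{-1},(4q_1-1)^{-1}]$ of regular functions on $M$, or the ring of holomorphic functions on $M$. On $U=(\mathbb{C}^*)^2$ with coordinates $u_1,u_2$ consider $$F=u_1+u_2+q_1\frac{u_2^2}{u_1}+q_2\frac1{u_2}\in\mathcal{O}[u_1^{\pm1},u_2^{\pm1}].$$ Let $\Omega^k$ be the module of relative $k$-forms on $U\times M$ over $M$ with coefficients in $\mathcal{O}[u_1^{\pm1},u_2^{\pm1}]$, $d$ the relative differential and $\tau=\theta^{-1}$. Let $$G=\frac{\Omega^2[\theta,\theta^{-1}]}{(d-\theta^{-1}dF\wedge)\Omega^1[\theta,\theta^{-1}]},\qquad G_0=\frac{\Omega^2[\theta]}{(\theta d-dF\wedge)\Omega^1[\theta]}$$ be the Gauss–Manin system and the Brieskorn lattice of $F$, and let $\nabla$ be the Gauss–Manin connection on $G$: for $g\in\Omega^2$, $i\in\mathbb{Z}$ and a vector field $X$ on $M$ (a $\mathbb{C}$-derivation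 of $\mathcal O$, acting on the coefficients of forms), $$\theta^2\nabla_{\partial_\theta}[g\theta^i]=[Fg\theta^i+i\,g\theta^{i+1}],\qquad \nabla_X[g\theta^i]=[X(g)\theta^i-X(F)\,g\,\theta^{i-1}].$$ Let $\omega=(\omega_0,\omega_1,\omega_2,\omega_3)$ be the classes of $1,\ \frac{q_2}{u_2},\ q_1q_2\frac{u_2}{u_1},\ q_1\frac{u_2^2}{u_1}$ times $\frac{du_1}{u_1}\wedge\frac{du_2}{u_2}$. Then: 1. $G_0$ is a free $\mathcal{O}[\theta]$-module with basis $\omega$, and the canonical map $G_0\to G$ is injective. Moreover $$\omega_1=-\theta\nabla_{q_2\partial_{q_2}}\omega_0,\quad \omega_2=\theta\nabla_{q_2\partial_{q_2}}\theta\nabla_{q_1\partial_{q_1}}\omega_0,\quad \omega_3=-\theta\nabla_{q_1\partial_{q_1}}\omega_0 .$$ 2. Put $G_\infty=\sum_i\mathcal{O}[\tau]\omega_i\subset G$. There is a form $S:G\times G\to\mathcal{O}[\theta,\theta^{-1}]$, linear in the first variable and semilinear in the second one with respect to $j:\theta\mapsto-\theta$, with $$S(\omega_0,\omega_2)=S(\omega_2,\omega_0)=\theta^2,\quad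 S(\omega_1,\omega_1)=2\theta^2,\quad S(\omega_1,\omega_3)=S(\omega_3,\omega_1)=\theta^2,\quad S(\omega_3,\omega_3)=\frac{2q_1}{4q_1-1}\theta^2$$ and $S(\omega_i,\omega_j)=0$ for all other $(i,j)$, such that, with $\mathcal{G}$ the bundle on $\mathbb{P}^1\times M$ obtained by gluing $G_0$ (chart $\theta\ne\infty$) and $G_\infty$ (chart $\theta\neq0$) along $G$, the tuple $(M,\mathcal{G},\nabla,S,2)$ is a quantum differential system. That is: $\mathcal{G}$ is trivial (it has a frame of global sections, which is both an $\mathcal O[\theta]$-basis of $G_0$ and an $\mathcal O[\tau]$-basis of $G_\infty$); $\nabla$ is flat; $\theta^2\nabla_{\partial_\theta}$ and $\theta\nabla_X$ preserve $G_0$ for all vector fields $X$ on $M$ (pole of order at most $2$ along $\theta=0$); $\tau\nabla_{\partial_\tau}$ and $\nabla_X$ preserve $G_\infty$ (logarithmic pole along $\theta=\infty$); $S$ is $\nabla$-flat; and $S$ induces non-degenerate (perfect) pairings $G_0\times j^*G_0\to\theta^2\mathcal{O}[\theta]$ and $G_\infty\times j^*G_\infty\to\theta^2\mathcal{O}[\tau]$.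 -/

import Mathlib

open scoped LaurentPolynomial

noncomputable section

namespace QDS

/-! ### Derivations of (Laurent) monomial algebras `K[M]` -/

section Derivations

variable {k K M : Type*} [CommRing k] [CommRing K] [Algebra k K] [AddCommMonoid M]

/-- A derivation of the ring of coefficients, applied coefficient by coefficient:
`∑ cₐ uᵃ ↦ ∑ D(cₐ) uᵃ`. -/
def coeffDer (D : Derivation k K K) :
    Derivation k (AddMonoidAlgebra K M) (AddMonoidAlgebra K M) where
  toFun := AddMonoidAlgebra.map (M := M) (D : K →+ K)
  map_add' := AddMonoidAlgebra.map_add _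
  map_smul' c x := by
    ext m
    simp
  map_one_eq_zero' := by
    ext m
    simp [AddMonoidAlgebra.one_def]
  leibniz' x y := by
    induction x using AddMonoidAlgebra.induction_linear with
    | zero => simp
    | add f g hf hg =>
      simp only [LinearMap.coe_mk, AddHom.coe_mk, smul_eq_mul] at hf hg ⊢
      simp only [add_mul, mul_add, AddMonoidAlgebra.map_add, hf, hg]
      abel
    | single a r =>
      induction y using AddMonoidAlgebra.induction_linear with
      | zero => simp
      | add f g hf hg =>
        simp only [LinearMap.coe_mk, AddHom.coe_mk, smul_eq_mul] at hf hg ⊢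
        simp only [add_mul, mul_add, AddMonoidAlgebra.map_add, hf, hg]
        abel
      | single b s =>
        simp [AddMonoidAlgebra.single_mul_single, AddMonoidAlgebra.single_add, add_comm b a]

@[simp]
theorem coeffDer_single (D : Derivation k K K) (m : M) (c : K) :
    coeffDer D (AddMonoidAlgebra.single m c) = AddMonoidAlgebra.single m (D c) :=
  AddMonoidAlgebra.map_single _ _ _

/-- The `K`-linear derivation `uᵃ ↦ w(a) uᵃ` attached to an additive weight `w`.
For `w` a coordinate of `ℤⁿ` it is the logarithmic vector field `uᵢ ∂/∂uᵢ`. -/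
def weightDer (w : M →+ ℤ) :
    Derivation K (AddMonoidAlgebra K M) (AddMonoidAlgebra K M) where
  toLinearMap :=
    (Finsupp.lsum K fun a : M =>
      LinearMap.toSpanSingleton K (AddMonoidAlgebra K M) (AddMonoidAlgebra.single a (w a : K))) ∘ₗ
      (AddMonoidAlgebra.coeffLinearEquiv K).toLinearMap
  map_one_eq_zero' := by
    simp [AddMonoidAlgebra.one_def]
  leibniz' x y := by
    induction x using AddMonoidAlgebra.induction_linear with
    | zero => simp
    | add f g hf hg =>
      simp only [smul_eq_mul, add_mul, mul_add, map_add] at hf hg ⊢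
      rw [hf, hg]
      abel
    | single a r =>
      induction y using AddMonoidAlgebra.induction_linear with
      | zero => simp
      | add f g hf hg =>
        simp only [smul_eq_mul, add_mul, mul_add, map_add] at hf hg ⊢
        rw [hf, hg]
        abel
      | single b s =>
        simp only [AddMonoidAlgebra.single_mul_single, LinearMap.comp_apply, smul_eq_mul,
          LinearEquiv.coe_coe, AddMonoidAlgebra.coeffLinearEquiv_apply,
          AddMonoidAlgebra.coeff_single, Finsupp.lsum_single, LinearMap.toSpanSingleton_apply,
          AddMonoidAlgebra.smul_single, add_comm b a, ← AddMonoidAlgebra.single_add]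
        congr 1
        push_cast [map_add]
        ring

@[simp]
theorem weightDer_single (w : M →+ ℤ) (m : M) (c : K) :
    weightDer w (AddMonoidAlgebra.single m c) = AddMonoidAlgebra.single m (w m * c) := by
  simp [weightDer, mul_comm]

theorem coeffDer_add (D E : Derivation k K K) (x : AddMonoidAlgebra K M) :
    coeffDer (D + E) x = coeffDer D x + coeffDer E x := by
  induction x using AddMonoidAlgebra.induction_linear with
  | zero => simp
  | add f g hf hg => simp only [map_add, hf, hg]; abel
  | single a r => simp [AddMonoidAlgebra.single_add]

theorem coeffDer_smul (c : K) (D : Derivation k K K) (x : AddMonoidAlgebra K M) :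
    coeffDer (c • D) x = c • coeffDer D x := by
  induction x using AddMonoidAlgebra.induction_linear with
  | zero => simp
  | add f g hf hg => simp only [map_add, hf, hg, smul_add]
  | single a r => simp

theorem coeffDer_smul_right (D : Derivation k K K) (c : K) (x : AddMonoidAlgebra K M) :
    coeffDer D (c • x) = D c • x + c • coeffDer D x := by
  induction x using AddMonoidAlgebra.induction_linear with
  | zero => simp
  | add f g hf hg => simp only [map_add, smul_add, hf, hg]; abel
  | single a r => simp [← AddMonoidAlgebra.single_add, mul_comm, add_comm]

theorem coeffDer_weightDer (D : Derivation k K K) (w : M →+ ℤ) (x : AddMonoidAlgebra K M) :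
    coeffDer D (weightDer w x) = weightDer w (coeffDer D x) := by
  induction x using AddMonoidAlgebra.induction_linear with
  | zero => simp
  | add f g hf hg => simp only [map_add, hf, hg]
  | single a r => simp

theorem map_weightDer {K' : Type*} [CommRing K'] (φ : K →+* K') (w : M →+ ℤ)
    (x : AddMonoidAlgebra K M) :
    AddMonoidAlgebra.mapRingHom M φ (weightDer w x) =
      weightDer w (AddMonoidAlgebra.mapRingHom M φ x) := by
  induction x using AddMonoidAlgebra.induction_linear with
  | zero => simp
  | add f g hf hg => simp only [map_add, hf, hg]
  | single a r => simp

theorem mapRingHom_smul {K' : Type*} [CommRing K'] (φ : K →+* K') (c : K)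
    (x : AddMonoidAlgebra K M) :
    AddMonoidAlgebra.mapRingHom M φ (c • x) = φ c • AddMonoidAlgebra.mapRingHom M φ x := by
  induction x using AddMonoidAlgebra.induction_linear with
  | zero => simp
  | add f g hf hg => simp only [map_add, smul_add, hf, hg]
  | single a r => simp

end Derivations

/-! ### The projective line over the base

`R` is the ring of functions on the base, `R[T;T⁻¹]` is `R[θ, θ⁻¹]` with `θ = T 1` and
`τ = θ⁻¹ = T (-1)`. -/

section Line

variable (R : Type*) [CommRing R]

/-- `R[θ] ⊆ R[θ, θ⁻¹]`: functions on the chart `U₀` centred at `θ = 0`. -/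
abbrev chartZero : Subalgebra R R[T;T⁻¹] := Algebra.adjoin R {LaurentPolynomial.T 1}

/-- `R[τ] ⊆ R[θ, θ⁻¹]`, `τ = θ⁻¹`: functions on the chart `U_∞` centred at `θ = ∞`. -/
abbrev chartInf : Subalgebra R R[T;T⁻¹] := Algebra.adjoin R {LaurentPolynomial.T (-1)}

/-- `θ` as an element of `R[θ]`. -/
def theta : chartZero R := ⟨LaurentPolynomial.T 1, Algebra.subset_adjoin rfl⟩

/-- The involution `j : θ ↦ -θ` of `R[θ, θ⁻¹]`. -/
def negTheta : R[T;T⁻¹] →+* R[T;T⁻¹] :=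
  LaurentPolynomial.eval₂ (LaurentPolynomial.C : R →+* R[T;T⁻¹])
    (-(LaurentPolynomial.isUnit_T (R := R) 1).unit)

theorem negTheta_C (r : R) : negTheta R (LaurentPolynomial.C r) = LaurentPolynomial.C r := by
  simp [negTheta]

theorem negTheta_T_one :
    negTheta R (LaurentPolynomial.T 1) = -LaurentPolynomial.T 1 := by
  simp [negTheta]

variable {k : Type*} [CommRing k] [Algebra k R]

/-- The vector field `θ ∂/∂θ`, a derivation of `R[θ, θ⁻¹]`. -/
def thetaDer (k : Type*) [CommRing k] [Algebra k R] : Derivation k R[T;T⁻¹] R[T;T⁻¹] :=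
  (weightDer (K := R) (AddMonoidHom.id ℤ)).restrictScalars k

variable {R}

/-- The lift to `R[θ, θ⁻¹]` of a vector field on the base, with `θ` constant. -/
def liftDer (X : Derivation k R R) : Derivation k R[T;T⁻¹] R[T;T⁻¹] := coeffDer X

end Line

/-! ### Connections and quantum differential systems -/

/-- A connection on the `B`-module `G`, relative to the ring of constants `k`: covariant
derivatives `∇_δ` along all `k`-derivations `δ` of `B`, linear in `δ` and satisfying the Leibniz
rule. -/
structure Connection (k B G : Type*) [CommRing k] [CommRing B] [Algebra k B] [AddCommGroup G]
    [Module B G] where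
  cov : Derivation k B B → G →+ G
  cov_add : ∀ δ ε m, cov (δ + ε) m = cov δ m + cov ε m
  cov_smul : ∀ (b : B) δ m, cov (b • δ) m = b • cov δ m
  leibniz : ∀ δ (b : B) m, cov δ (b • m) = δ b • m + b • cov δ m

/-- Flatness: `[∇_δ, ∇_ε] = ∇_[δ, ε]`. -/
def Connection.IsFlat {k B G : Type*} [CommRing k] [CommRing B] [Algebra k B] [AddCommGroup G]
    [Module B G] (nabla : Connection k B G) : Prop :=
  ∀ δ ε m, nabla.cov δ (nabla.cov ε m) - nabla.cov ε (nabla.cov δ m) = nabla.cov ⁅δ, ε⁆ m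

section Systems

variable {R G : Type*} [CommRing R] [AddCommGroup G] [Module R[T;T⁻¹] G]

/-- On a chart with ring of functions `A`, where the bundle has the module of sections `N`, the
sesquilinear form `S` is a non-degenerate pairing with values in `θᵈ A`: it takes its values there
and identifies `N` with the module of linear forms on `N` with values in `θᵈ A`. -/
def IsPerfectOn (A : Subalgebra R R[T;T⁻¹]) (N : Submodule A G)
    (S : G →ₗ[R[T;T⁻¹]] G →ₛₗ[negTheta R] R[T;T⁻¹]) (d : ℤ) : Prop :=
  (∀ m ∈ N, ∀ n ∈ N, ∃ a ∈ A, S m n = LaurentPolynomial.T d * a) ∧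
  ∀ φ : N →ₗ[A] A, ∃! n : N, ∀ m : N,
    S (m : G) (n : G) = LaurentPolynomial.T d * (φ m : R[T;T⁻¹])

/-- A quantum differential system `(M, 𝒢, ∇, S, d)` over a base `M` whose ring of functions is the
`ℂ`-algebra `R`.  The bundle `𝒢` on `ℙ¹ × M` is given by its module `G` of sections over
`θ ≠ 0, ∞` and by its modules of sections `G₀` over `U₀ × M` and `G_∞` over `U_∞ × M`. -/
structure IsQuantumDifferentialSystem [Algebra ℂ R]
    (G₀ : Submodule (chartZero R) G) (Ginf : Submodule (chartInf R) G)
    (nabla : Connection ℂ R[T;T⁻¹] G)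
    (S : G →ₗ[R[T;T⁻¹]] G →ₛₗ[negTheta R] R[T;T⁻¹]) (d : ℤ) : Prop where
  /-- `𝒢` is trivial: there is a frame of global sections. -/
  trivial : ∃ (r : ℕ) (b : Module.Basis (Fin r) R[T;T⁻¹] G),
    G₀ = Submodule.span (chartZero R) (Set.range b) ∧
    Ginf = Submodule.span (chartInf R) (Set.range b)
  flat : nabla.IsFlat
  /-- Pole of order at most two along `θ = 0`: `θ² ∇_{∂_θ}` and `θ ∇_X` preserve `G₀`. -/
  pole_theta : ∀ m ∈ G₀, (LaurentPolynomial.T 1 : R[T;T⁻¹]) • nabla.cov (thetaDer R ℂ) m ∈ G₀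
  pole_base : ∀ (X : Derivation ℂ R R), ∀ m ∈ G₀,
    (LaurentPolynomial.T 1 : R[T;T⁻¹]) • nabla.cov (liftDer X) m ∈ G₀
  /-- Logarithmic pole along `θ = ∞`: `τ ∇_{∂_τ} = -θ ∇_{∂_θ}` and `∇_X` preserve `G_∞`. -/
  log_theta : ∀ m ∈ Ginf, nabla.cov (thetaDer R ℂ) m ∈ Ginf
  log_base : ∀ (X : Derivation ℂ R R), ∀ m ∈ Ginf, nabla.cov (liftDer X) m ∈ Ginf
  /-- `S` is `∇`-flat; `θ ∂_θ` and the lifts `X` are invariant under `j` and generate all vector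
  fields. -/
  flat_theta : ∀ m n, thetaDer R ℂ (S m n) =
    S (nabla.cov (thetaDer R ℂ) m) n + S m (nabla.cov (thetaDer R ℂ) n)
  flat_base : ∀ (X : Derivation ℂ R R) (m n : G), liftDer X (S m n) =
    S (nabla.cov (liftDer X) m) n + S m (nabla.cov (liftDer X) n)
  /-- `S : 𝒢 × j^*𝒢 → θᵈ 𝒪` is non-degenerate on both charts. -/
  nondeg_zero : IsPerfectOn (chartZero R) G₀ S d
  nondeg_inf : IsPerfectOn (chartInf R) Ginf S d

end Systems

/-! ### Gauss–Manin system and Brieskorn lattice of a function on `(ℂ^*)² × M` -/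

section GaussManin

/-- Functions on the torus `(u₁, u₂)` with coefficients in `K`: `K[u₁^{±1}, u₂^{±1}]`.  The
monomial `u₁^a u₂^b` is `AddMonoidAlgebra.single (a, b) 1`. -/
abbrev TorusFun (K : Type*) [CommRing K] := AddMonoidAlgebra K (ℤ × ℤ)

variable {K : Type*} [CommRing K]

/-- `u₁ ∂/∂u₁`. -/
def D₁ : Derivation K (TorusFun K) (TorusFun K) := weightDer (AddMonoidHom.fst ℤ ℤ)

/-- `u₂ ∂/∂u₂`. -/
def D₂ : Derivation K (TorusFun K) (TorusFun K) := weightDer (AddMonoidHom.snd ℤ ℤ)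

/-- The map `η ↦ a dη - dH ∧ η` from relative `1`-forms to relative `2`-forms on the torus.
The pair `(g₁, g₂)` stands for `η = g₁ du₁/u₁ + g₂ du₂/u₂`, and the function `g` stands for
the `2`-form `g (du₁/u₁) ∧ (du₂/u₂)`. -/
def twistedD (a : K) (H : TorusFun K) : (TorusFun K × TorusFun K) →ₗ[K] TorusFun K where
  toFun η := a • (D₁ η.2 - D₂ η.1) - (D₁ H * η.2 - D₂ H * η.1)
  map_add' η ξ := by
    simp only [Prod.fst_add, Prod.snd_add, map_add, smul_sub, smul_add, mul_add]
    abel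
  map_smul' c η := by
    simp only [Prod.smul_fst, Prod.smul_snd, Derivation.map_smul, smul_sub, mul_smul_comm,
      smul_comm c a, RingHom.id_apply]

theorem twistedD_apply (a : K) (H : TorusFun K) (η : TorusFun K × TorusFun K) :
    twistedD a H η = a • (D₁ η.2 - D₂ η.1) - (D₁ H * η.2 - D₂ H * η.1) := rfl

variable {R : Type*} [CommRing R]

/-- Change of coefficients. -/
def TorusFun.baseChange (K : Type*) [CommRing K] [Algebra R K] : TorusFun R →+* TorusFun K :=
  AddMonoidAlgebra.mapRingHom (ℤ × ℤ) (algebraMap R K)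

/-- `θ⁻¹ F`. -/
def phase (F : TorusFun R) : TorusFun R[T;T⁻¹] :=
  (LaurentPolynomial.T (-1) : R[T;T⁻¹]) • F.baseChange R[T;T⁻¹]

/-- The Gauss–Manin system
`G = Ω²[θ, θ⁻¹] / (d - θ⁻¹ dF ∧) Ω¹[θ, θ⁻¹]` of `F ∈ R[u₁^{±1}, u₂^{±1}]`, where `d` is the
differential relative to the base. -/
def GaussManin (F : TorusFun R) : Type _ :=
  TorusFun R[T;T⁻¹] ⧸ LinearMap.range (twistedD 1 (phase F))

instance (F : TorusFun R) : AddCommGroup (GaussManin F) :=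
  inferInstanceAs (AddCommGroup (_ ⧸ LinearMap.range (twistedD 1 (phase F))))

instance (F : TorusFun R) : Module R[T;T⁻¹] (GaussManin F) :=
  inferInstanceAs (Module _ (_ ⧸ LinearMap.range (twistedD 1 (phase F))))

/-- The class in `G` of a form. -/
def GaussManin.mk (F : TorusFun R) : TorusFun R[T;T⁻¹] →ₗ[R[T;T⁻¹]] GaussManin F :=
  (LinearMap.range (twistedD 1 (phase F))).mkQ

theorem GaussManin.mk_surjective (F : TorusFun R) : Function.Surjective (GaussManin.mk F) :=
  Submodule.mkQ_surjective _

/-- The Brieskorn module `Ω²[θ] / (θ d - dF ∧) Ω¹[θ]` of `F`. -/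
def BrieskornModule (F : TorusFun R) : Type _ :=
  TorusFun (chartZero R) ⧸
    LinearMap.range (twistedD (theta R) (F.baseChange (chartZero R)))

instance (F : TorusFun R) : AddCommGroup (BrieskornModule F) :=
  inferInstanceAs (AddCommGroup (_ ⧸ LinearMap.range
    (twistedD (theta R) (F.baseChange (chartZero R)))))

instance (F : TorusFun R) : Module (chartZero R) (BrieskornModule F) :=
  inferInstanceAs (Module _ (_ ⧸ LinearMap.range
    (twistedD (theta R) (F.baseChange (chartZero R)))))

/-- The class in the Brieskorn module of a form. -/
def BrieskornModule.mk (F : TorusFun R) :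
    TorusFun (chartZero R) →ₗ[chartZero R] BrieskornModule F :=
  (LinearMap.range (twistedD (theta R) (F.baseChange (chartZero R)))).mkQ

/-- The inclusion `Ω²[θ] → Ω²[θ, θ⁻¹]`, followed by the projection to `G`. -/
def formToGaussManin (F : TorusFun R) : TorusFun (chartZero R) →ₗ[chartZero R] GaussManin F where
  toFun g := GaussManin.mk F (g.baseChange R[T;T⁻¹])
  map_add' g h := by rw [map_add, map_add]
  map_smul' c g := by
    have : (c • g).baseChange R[T;T⁻¹] = (c : R[T;T⁻¹]) • g.baseChange R[T;T⁻¹] := by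
      ext m
      simp [TorusFun.baseChange]
    rw [this, map_smul]
    rfl

/-- The canonical map from the Brieskorn module to the Gauss–Manin system. -/
def toGaussManin (F : TorusFun R) : BrieskornModule F →ₗ[chartZero R] GaussManin F :=
  Submodule.liftQ _ (formToGaussManin F) <| by
    rintro _ ⟨η, rfl⟩
    rw [LinearMap.mem_ker]
    refine (Submodule.Quotient.mk_eq_zero _).2 ?_
    let e := AddMonoidAlgebra.mapRingHom (ℤ × ℤ) (algebraMap (chartZero R) R[T;T⁻¹])
    have hF : e (F.baseChange (chartZero R)) = F.baseChange R[T;T⁻¹] := by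
      refine AddMonoidAlgebra.ext (Finsupp.ext fun m => ?_)
      simp only [e, TorusFun.baseChange, AddMonoidAlgebra.coeff_mapRingHom]
      exact (IsScalarTower.algebraMap_apply R (chartZero R) R[T;T⁻¹] _).symm
    have hs : ∀ (c : chartZero R) (g : TorusFun (chartZero R)), e (c • g) = (c : R[T;T⁻¹]) • e g :=
      fun c g => mapRingHom_smul _ c g
    have hT : (LaurentPolynomial.T (-1) : R[T;T⁻¹]) * (theta R : R[T;T⁻¹]) = 1 := by
      change LaurentPolynomial.T (-1) * LaurentPolynomial.T 1 = 1
      rw [← LaurentPolynomial.T_add, neg_add_cancel, LaurentPolynomial.T_zero]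
    refine ⟨((theta R : R[T;T⁻¹]) • e η.1, (theta R : R[T;T⁻¹]) • e η.2), ?_⟩
    have h₁ : ∀ g, e (D₁ g) = D₁ (e g) := map_weightDer _ _
    have h₂ : ∀ g, e (D₂ g) = D₂ (e g) := map_weightDer _ _
    change _ = e _
    rw [twistedD_apply, twistedD_apply, map_sub, map_sub, map_mul, map_mul, hs, map_sub, h₁, h₂, h₁,
      h₂, hF, phase]
    simp only [Derivation.map_smul, smul_mul_smul_comm, hT, one_smul, smul_sub]

/-- The Brieskorn lattice `G₀ ⊆ G`: the image of `Ω²[θ]` in the Gauss–Manin system. -/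
def brieskornLattice (F : TorusFun R) : Submodule (chartZero R) (GaussManin F) :=
  LinearMap.range (toGaussManin F)

section Connection

variable {k : Type*} [CommRing k] [Algebra k R]

/-- The operator `g ↦ δ(g) - δ(θ⁻¹F) g` on forms, that is the action of `δ` on
integrands `e^{-F/θ} g`. -/
def phaseCov (F : TorusFun R) (δ : Derivation k R[T;T⁻¹] R[T;T⁻¹]) :
    TorusFun R[T;T⁻¹] →+ TorusFun R[T;T⁻¹] where
  toFun g := coeffDer δ g - coeffDer δ (phase F) * g
  map_zero' := by simp
  map_add' g h := by
    rw [map_add, mul_add]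
    abel

theorem phaseCov_apply (F : TorusFun R) (δ : Derivation k R[T;T⁻¹] R[T;T⁻¹])
    (g : TorusFun R[T;T⁻¹]) :
    phaseCov F δ g = coeffDer δ g - coeffDer δ (phase F) * g := rfl

theorem phaseCov_twistedD (F : TorusFun R) (δ : Derivation k R[T;T⁻¹] R[T;T⁻¹])
    (η : TorusFun R[T;T⁻¹] × TorusFun R[T;T⁻¹]) :
    phaseCov F δ (twistedD 1 (phase F) η) =
      twistedD 1 (phase F) (phaseCov F δ η.1, phaseCov F δ η.2) := by
  have h₁ : ∀ g, coeffDer δ (D₁ g) = D₁ (coeffDer δ g) := coeffDer_weightDer _ _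
  have h₂ : ∀ g, coeffDer δ (D₂ g) = D₂ (coeffDer δ g) := coeffDer_weightDer _ _
  simp only [twistedD_apply, phaseCov_apply, one_smul, map_sub, Derivation.leibniz, smul_eq_mul,
    h₁, h₂]
  ring

/-- The Gauss–Manin connection on the Gauss–Manin system, `∇_δ [g] = [δ(g) - δ(θ⁻¹F) g]`.
Explicitly `θ² ∇_{∂_θ} [∑ gᵢ θⁱ] = [∑ F gᵢ θⁱ + ∑ i gᵢ θ^{i+1}]` and, for a vector field `X` of
the base, `∇_X [g] = [X(g) - θ⁻¹ X(F) g]`. -/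
def gaussManinConnection (k : Type*) [CommRing k] [Algebra k R] (F : TorusFun R) :
    Connection k R[T;T⁻¹] (GaussManin F) where
  cov δ := QuotientAddGroup.map (LinearMap.range (twistedD 1 (phase F))).toAddSubgroup
    (LinearMap.range (twistedD 1 (phase F))).toAddSubgroup (phaseCov F δ) <| by
      rintro _ ⟨η, rfl⟩
      exact ⟨_, (phaseCov_twistedD F δ η).symm⟩
  cov_add δ ε m := by
    obtain ⟨g, rfl⟩ := GaussManin.mk_surjective F m
    change GaussManin.mk F (phaseCov F (δ + ε) g) =
      GaussManin.mk F (phaseCov F δ g) + GaussManin.mk F (phaseCov F ε g)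
    rw [← map_add]
    congr 1
    simp only [phaseCov_apply, coeffDer_add]
    ring
  cov_smul b δ m := by
    obtain ⟨g, rfl⟩ := GaussManin.mk_surjective F m
    change GaussManin.mk F (phaseCov F (b • δ) g) = b • GaussManin.mk F (phaseCov F δ g)
    rw [← map_smul]
    congr 1
    simp only [phaseCov_apply, coeffDer_smul, smul_sub, smul_mul_assoc]
  leibniz δ b m := by
    obtain ⟨g, rfl⟩ := GaussManin.mk_surjective F m
    change GaussManin.mk F (phaseCov F δ (b • g)) =
      δ b • GaussManin.mk F g + b • GaussManin.mk F (phaseCov F δ g)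
    rw [← map_smul, ← map_smul, ← map_add]
    congr 1
    simp only [phaseCov_apply, coeffDer_smul_right, smul_sub, mul_smul_comm]
    abel

theorem gaussManinConnection_mk (F : TorusFun R) (δ : Derivation k R[T;T⁻¹] R[T;T⁻¹])
    (g : TorusFun R[T;T⁻¹]) :
    (gaussManinConnection k F).cov δ (GaussManin.mk F g) = GaussManin.mk F (phaseCov F δ g) := rfl

end Connection

end GaussManin

/-! ### The Landau–Ginzburg model of the Hirzebruch surface `𝔽₂` -/

/-- The base `M = {(q₁, q₂) ∈ ℂ² | q₁ q₂ ≠ 0, q₁ ≠ 1/4}`. -/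
def M : Set (ℂ × ℂ) := {q | q.1 * q.2 ≠ 0 ∧ q.1 ≠ 1 / 4}

/-- The ring `ℂ[q₁, q₁⁻¹, q₂, q₂⁻¹, (4q₁ - 1)⁻¹]` of regular functions on `M`. -/
def regularFunctions : Subalgebra ℂ (M → ℂ) :=
  Algebra.adjoin ℂ {fun q => q.1.1, fun q => (q.1.1)⁻¹, fun q => q.1.2, fun q => (q.1.2)⁻¹,
    fun q => (4 * q.1.1 - 1)⁻¹}

/-- The ring of holomorphic functions on `M` (an open subset of `ℂ²`). -/
def holomorphicFunctions : Subalgebra ℂ (M → ℂ) where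
  carrier := {f | ∃ g : ℂ × ℂ → ℂ, DifferentiableOn ℂ g M ∧ ∀ q : M, f q = g q}
  mul_mem' := by
    rintro f f' ⟨g, hg, hf⟩ ⟨g', hg', hf'⟩
    exact ⟨g * g', hg.mul hg', fun q => by simp [hf, hf']⟩
  add_mem' := by
    rintro f f' ⟨g, hg, hf⟩ ⟨g', hg', hf'⟩
    exact ⟨g + g', hg.add hg', fun q => by simp [hf, hf']⟩
  algebraMap_mem' c := ⟨fun _ => c, differentiableOn_const c, fun _ => rfl⟩

section Hirzebruch

variable {R : Type*} [CommRing R]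

/-- `F = u₁ + u₂ + q₁ u₂² / u₁ + q₂ / u₂`. -/
def F (q₁ q₂ : R) : TorusFun R :=
  .single (1, 0) 1 + .single (0, 1) 1 + .single (-1, 2) q₁ + .single (0, -1) q₂

/-- The functions `1, q₂ / u₂, q₁ q₂ u₂ / u₁, q₁ u₂² / u₁`; they are the coefficients of the forms
defining `ω₀, ω₁, ω₂, ω₃` with respect to `(du₁/u₁) ∧ (du₂/u₂)`. -/
def omegaFun (q₁ q₂ : R) : Fin 4 → TorusFun R :=
  ![.single (0, 0) 1, .single (0, -1) q₂, .single (-1, 1) (q₁ * q₂), .single (-1, 2) q₁]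

/-- The class of the form `ωᵢ` in the Brieskorn module. -/
def omega (q₁ q₂ : R) (i : Fin 4) : BrieskornModule (F q₁ q₂) :=
  BrieskornModule.mk (F q₁ q₂) ((omegaFun q₁ q₂ i).baseChange (chartZero R))

/-- The class of the form `ωᵢ` in the Gauss–Manin system. -/
def omegaGM (q₁ q₂ : R) (i : Fin 4) : GaussManin (F q₁ q₂) :=
  toGaussManin (F q₁ q₂) (omega q₁ q₂ i)

/-- The matrix `θ⁻² S(ωᵢ, ωⱼ)`. -/
def gram (q₁ : R) : Matrix (Fin 4) (Fin 4) R :=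
  !![0, 0, 1, 0;
     0, 2, 0, 1;
     1, 0, 0, 0;
     0, 1, 0, 2 * q₁ * Ring.inverse (4 * q₁ - 1)]

end Hirzebruch

end QDS

end

/-! Modulo the image of `θd - dF∧`, the classes `π (a, b)` of the monomials `u₁ᵃu₂ᵇ` satisfy exactly
the relations obtained from the monomial 1-forms (`range_twistedD_le_ker_iff`). So the quotient is
the universal module carrying a solution of a linear system on the lattice `ℤ²`, and finding a basis
means solving that system.

Call `b ↦ π (a, b)` column `a`. Eliminating one term between the two relations expresses twice
column `a + 1` through column `a`, and `q₁` times column `a - 1` through columns `a` and `a + 1`.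
What remains on column `0` is a recurrence of order four with extreme coefficients `4q₁ - 1` and
`q₂²`. As `2`, `q₁`, `q₂` and `4q₁ - 1` are units, a solution is determined by four consecutive
values on column `0` (`mem_of_mem`), and these are arbitrary (`exists_solution`). An invertible
change of coordinates replaces them by the `ωᵢ`: the first fact gives generation, and the second,
applied to the standard basis of `A⁴`, gives independence. Nothing depends on whether `θ` is a unit,
so the same argument covers `R[θ]` and `R[θ, θ⁻¹]`. Hence `G₀` embeds in `G` and is spanned there by
`ω`.

In the frame `ω` the connection has the form `d + P + θ⁻¹Q` with `P`, `Q` free of `θ`: the products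
of the `ωᵢ` with the terms of `F` reduce to combinations of degree at most one in `θ`. Both pole
conditions can be read off from this form. For a constant Gram matrix `g`, flatness of `S` becomes a
Leibniz identity between `P` and `g` and the symmetry `Qᵀg = gQ`, while perfectness becomes
invertibility of `det g = -(4q₁ - 1)⁻¹` (`isQuantumDifferentialSystem_of_matrix`). Flatness of `∇`
holds for any `F`, because `∇_δ` is `δ` conjugated by `e^{-F/θ}`. -/

theorem exists_int_seq {X : Type*} (r : ℤ → X → X → Prop) (hf : ∀ n x, ∃ y, r n x y)
    (hb : ∀ n y, ∃ x, r n x y) (x : X) : ∃ s : ℤ → X, s 0 = x ∧ ∀ n, r n (s n) (s (n + 1)) := by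
  choose f hf using hf
  choose g hg using hb
  let fwd : ℕ → X := Nat.rec x fun n y => f n y
  let bwd : ℕ → X := Nat.rec x fun n y => g (Int.negSucc n) y
  -- Both halves start at `x`, placed at index `0`; hence index `-(n + 1)` carries `bwd (n + 1)`.
  refine ⟨fun n => Int.rec (motive := fun _ => X) fwd (fun n => bwd (n + 1)) n, rfl, ?_⟩
  rintro (n | n)
  · exact hf n (fwd n)
  · cases n with
    | zero => exact hg (Int.negSucc 0) x
    | succ n =>
      have : Int.negSucc (n + 1) + 1 = Int.negSucc n := by omega
      rw [this]
      exact hg (Int.negSucc (n + 1)) (bwd (n + 1))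

namespace QDS

/-! ### The lattice system for the classes of the monomials -/

section Solutions

variable {A W : Type*} [CommRing A] [AddCommGroup W] [Module A W]

/-- The relations satisfied by the classes `π (a, b)` of the monomials `u₁ᵃ u₂ᵇ` modulo the image of
`θ d - dF ∧`. -/
structure IsSolution (θ q₁ q₂ : A) (π : ℤ × ℤ → W) : Prop where
  rel₁ : ∀ a b : ℤ, π (a + 1, b) = q₁ • π (a - 1, b + 2) + (θ * a) • π (a, b)
  rel₂ : ∀ a b : ℤ,
    π (a, b + 1) + (2 * q₁) • π (a - 1, b + 2) - q₂ • π (a, b - 1) = (θ * b) • π (a, b)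

theorem D₁_single (a b : ℤ) (c : A) :
    D₁ (.single (a, b) c : TorusFun A) = .single (a, b) (a * c) := weightDer_single _ _ _

theorem D₂_single (a b : ℤ) (c : A) :
    D₂ (.single (a, b) c : TorusFun A) = .single (a, b) (b * c) := weightDer_single _ _ _

theorem twistedD_single_right (θ q₁ q₂ : A) (a b : ℤ) :
    twistedD θ (F q₁ q₂) (0, .single (a, b) 1) =
      .single (a, b) (θ * a) - .single (a + 1, b) 1 + .single (a - 1, b + 2) q₁ := by
  simp only [twistedD_apply, F, map_add, D₁_single, map_zero, add_mul,
    AddMonoidAlgebra.single_mul_single, Prod.mk_add_mk]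
  simp
  ring_nf

theorem twistedD_single_left (θ q₁ q₂ : A) (a b : ℤ) :
    twistedD θ (F q₁ q₂) (.single (a, b) 1, 0) =
      .single (a, b + 1) 1 + .single (a - 1, b + 2) (2 * q₁) - .single (a, b - 1) q₂ -
        .single (a, b) (θ * b) := by
  simp only [twistedD_apply, F, map_add, D₂_single, map_zero, add_mul,
    AddMonoidAlgebra.single_mul_single, Prod.mk_add_mk]
  simp
  ring_nf

/-- This turns linear maps out of the quotient into solutions of the lattice system, and so drives
both generation and independence. -/
theorem range_twistedD_le_ker_iff (θ q₁ q₂ : A) (p : TorusFun A →ₗ[A] W) :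
    LinearMap.range (twistedD θ (F q₁ q₂)) ≤ LinearMap.ker p ↔
      IsSolution θ q₁ q₂ fun m => p (.single m 1) := by
  have hp : ∀ m c, p (.single m c) = c • p (.single m 1) := fun m c => by
    rw [← map_smul, AddMonoidAlgebra.smul_single, smul_eq_mul, mul_one]
  have hr : ∀ a b : ℤ, p (twistedD θ (F q₁ q₂) (0, .single (a, b) 1)) = 0 ↔
      p (.single (a + 1, b) 1) =
        q₁ • p (.single (a - 1, b + 2) 1) + (θ * a) • p (.single (a, b) 1) := fun a b => by
    rw [twistedD_single_right, map_add, map_sub, hp (a, b), hp (a - 1, b + 2)]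
    constructor <;> intro h <;> linear_combination (norm := module) -h
  have hl : ∀ a b : ℤ, p (twistedD θ (F q₁ q₂) (.single (a, b) 1, 0)) = 0 ↔
      p (.single (a, b + 1) 1) + (2 * q₁) • p (.single (a - 1, b + 2) 1)
        - q₂ • p (.single (a, b - 1) 1) = (θ * b) • p (.single (a, b) 1) := fun a b => by
    rw [twistedD_single_left, map_sub, map_sub, map_add, hp (a, b), hp (a - 1, b + 2),
      hp (a, b - 1), sub_eq_zero]
  constructor
  · intro h
    exact ⟨fun a b => (hr a b).1 (h ⟨_, rfl⟩), fun a b => (hl a b).1 (h ⟨_, rfl⟩)⟩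
  · rintro h _ ⟨⟨g₁, g₂⟩, rfl⟩
    -- By linearity it is enough to test each component of the 1-form on monomials.
    have h₁ : p ∘ₗ twistedD θ (F q₁ q₂) ∘ₗ LinearMap.inl A _ _ = 0 := by
      ext ⟨a, b⟩
      exact (hl a b).2 (h.rel₂ a b)
    have h₂ : p ∘ₗ twistedD θ (F q₁ q₂) ∘ₗ LinearMap.inr A _ _ = 0 := by
      ext ⟨a, b⟩
      exact (hr a b).2 (h.rel₁ a b)
    have : (g₁, g₂) = LinearMap.inl A _ _ g₁ + LinearMap.inr A _ _ g₂ := by simp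
    rw [LinearMap.mem_ker, this, map_add, map_add]
    exact (congrArg₂ (· + ·) (LinearMap.congr_fun h₁ g₁) (LinearMap.congr_fun h₂ g₂)).trans
      (add_zero 0)

namespace IsSolution

variable {θ q₁ q₂ : A} {π : ℤ × ℤ → W}

/-- Eliminating `π (a - 1, b + 2)` between the two relations leaves only columns `a` and `a + 1`. -/
theorem column_succ (h : IsSolution θ q₁ q₂ π) (a b : ℤ) :
    (2 : A) • π (a + 1, b) = (θ * (b + 2 * a)) • π (a, b) + q₂ • π (a, b - 1) - π (a, b + 1) := by
  linear_combination (norm := module) (2 : A) • h.rel₁ a b + h.rel₂ a b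

theorem column_pred (h : IsSolution θ q₁ q₂ π) (a b : ℤ) :
    q₁ • π (a - 1, b) = π (a + 1, b - 2) - (θ * a) • π (a, b - 2) := by
  have := h.rel₁ a (b - 2)
  rw [sub_add_cancel] at this
  rw [this, add_sub_cancel_right]

/-- The classes of the powers of `u₂` satisfy a linear recurrence of order four. -/
theorem recurrence (h : IsSolution θ q₁ q₂ π) (b : ℤ) :
    (4 * q₁ - 1) • π (0, b + 2) = -(θ * (2 * b + 1)) • π (0, b + 1)
      + (θ ^ 2 * b ^ 2 - 2 * q₂) • π (0, b) + (q₂ * θ * (2 * b - 1)) • π (0, b - 1)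
      + q₂ ^ 2 • π (0, b - 2) := by
  have e₁ := h.column_succ (-1) (b + 2)
  have e₂ := h.rel₁ 0 b
  have e₃ := h.rel₁ 0 (b - 1)
  have e₄ := h.rel₁ 0 (b + 1)
  have e₅ := h.column_succ 0 b
  have e₆ := h.column_succ 0 (b - 1)
  have e₇ := h.column_succ 0 (b + 1)
  have i₁ : b + 2 - 1 = b + 1 := by ring
  have i₂ : b + 2 + 1 = b + 3 := by ring
  have i₃ : b - 1 + 2 = b + 1 := by ring
  have i₄ : b + 1 + 2 = b + 3 := by ring
  have i₅ : b - 1 - 1 = b - 2 := by ring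
  have i₆ : b + 1 + 1 = b + 2 := by ring
  simp only [neg_add_cancel, zero_add, zero_sub, add_sub_cancel_right, sub_add_cancel,
    i₁, i₂, i₃, i₄, i₅, i₆] at e₁ e₂ e₃ e₄ e₅ e₆ e₇
  push_cast at e₁ e₂ e₃ e₄ e₅ e₆ e₇
  -- Column `0` is expressed through column `-1` by `e₁`, `q₁` times column `-1` is a shift of
  -- column `1` by `e₂`, `e₃`, `e₄`, and column `1` returns to column `0` by `e₅`, `e₆`, `e₇`.
  linear_combination (norm := module) (2 * q₁) • e₁ - (2 * θ * b) • e₂ - (2 * q₂) • e₃ +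
    (2 : A) • e₄ + (θ * b) • e₅ + q₂ • e₆ - e₇

/-- The recurrence runs upwards on column `0` by dividing by `4q₁ - 1` and downwards by dividing by
`q₂²`. The other columns follow by dividing by `2` to the right and by `q₁` to the left. -/
theorem mem_of_mem (h : IsSolution θ q₁ q₂ π) (h2 : IsUnit (2 : A)) (h₁ : IsUnit q₁)
    (h₂ : IsUnit q₂) (h₄ : IsUnit (4 * q₁ - 1)) (N : Submodule A W) (hm₂ : π (0, -2) ∈ N)
    (hm₁ : π (0, -1) ∈ N) (h0 : π (0, 0) ∈ N) (hp₁ : π (0, 1) ∈ N) (m : ℤ × ℤ) : π m ∈ N := by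
  have key : ∀ {u : A} {x : W}, IsUnit u → u • x ∈ N → x ∈ N := fun hu hx =>
    (Submodule.smul_mem_iff_of_isUnit N hu).1 hx
  have col0 : ∀ b : ℤ, π (0, b - 2) ∈ N ∧ π (0, b - 1) ∈ N ∧ π (0, b) ∈ N ∧ π (0, b + 1) ∈ N := by
    intro b
    induction b using Int.induction_on with
    | zero => exact ⟨hm₂, hm₁, h0, hp₁⟩
    | succ b ih =>
      obtain ⟨i₁, i₂, i₃, i₄⟩ := ih
      refine ⟨by convert i₂ using 3; ring, by convert i₃ using 3; ring, i₄, key h₄ ?_⟩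
      rw [add_assoc, one_add_one_eq_two, h.recurrence]
      exact N.add_mem (N.add_mem (N.add_mem (N.smul_mem _ i₄) (N.smul_mem _ i₃))
        (N.smul_mem _ i₂)) (N.smul_mem _ i₁)
    | pred b ih =>
      obtain ⟨i₁, i₂, i₃, i₄⟩ := ih
      refine ⟨key (h₂.pow 2) ?_, by convert i₁ using 3; ring, i₂, by convert i₃ using 3; ring⟩
      have := h.recurrence (-b - 1)
      have j₁ : -(b : ℤ) - 1 + 2 = -b + 1 := by ring
      have j₂ : -(b : ℤ) - 1 - 1 = -b - 2 := by ring
      rw [j₁, sub_add_cancel, j₂] at this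
      rw [← sub_eq_iff_eq_add'] at this
      rw [← this]
      exact N.sub_mem (N.smul_mem _ i₄) (N.add_mem (N.add_mem (N.smul_mem _ i₃) (N.smul_mem _ i₂))
        (N.smul_mem _ i₁))
  have next : ∀ a, (∀ b, π (a, b) ∈ N) → ∀ b, π (a + 1, b) ∈ N := fun a ih b => by
    refine key h2 ?_
    rw [h.column_succ]
    exact N.sub_mem (N.add_mem (N.smul_mem _ (ih _)) (N.smul_mem _ (ih _))) (ih _)
  suffices ∀ a, (∀ b, π (a, b) ∈ N) ∧ ∀ b, π (a + 1, b) ∈ N from (this m.1).1 m.2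
  intro a
  induction a using Int.induction_on with
  | zero => exact ⟨fun b => (col0 b).2.2.1, next 0 fun b => (col0 b).2.2.1⟩
  | succ a ih => exact ⟨ih.2, next _ ih.2⟩
  | pred a ih =>
    refine ⟨fun b => key h₁ ?_, by simpa using ih.1⟩
    rw [h.column_pred]
    exact N.sub_mem (ih.2 _) (N.smul_mem _ (ih.1 _))

end IsSolution

theorem exists_recurrent_seq {θ q₁ q₂ : A} (h₂ : IsUnit q₂) (h₄ : IsUnit (4 * q₁ - 1))
    (w₀ w₁ w₂ w₃ : W) : ∃ f : ℤ → W, (f (-2) = w₀ ∧ f (-1) = w₁ ∧ f 0 = w₂ ∧ f 1 = w₃) ∧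
      ∀ b : ℤ, (4 * q₁ - 1) • f (b + 2) = -(θ * (2 * b + 1)) • f (b + 1)
        + (θ ^ 2 * b ^ 2 - 2 * q₂) • f b + (q₂ * θ * (2 * b - 1)) • f (b - 1)
        + q₂ ^ 2 • f (b - 2) := by
  -- The state at `b` is the window `(f (b - 2), f (b - 1), f b, f (b + 1))`, so `f b` is its third
  -- entry.
  obtain ⟨s, hs, hr⟩ := exists_int_seq (X := W × W × W × W)
    (fun b x y => y.1 = x.2.1 ∧ y.2.1 = x.2.2.1 ∧ y.2.2.1 = x.2.2.2 ∧
      (4 * q₁ - 1) • y.2.2.2 = -(θ * (2 * b + 1)) • x.2.2.2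
        + (θ ^ 2 * b ^ 2 - 2 * q₂) • x.2.2.1 + (q₂ * θ * (2 * b - 1)) • x.2.1 + q₂ ^ 2 • x.1)
    (fun b x => ⟨(_, _, _, h₄.unit⁻¹ • (-(θ * (2 * b + 1)) • x.2.2.2
        + (θ ^ 2 * b ^ 2 - 2 * q₂) • x.2.2.1 + (q₂ * θ * (2 * b - 1)) • x.2.1 + q₂ ^ 2 • x.1)),
      rfl, rfl, rfl, smul_inv_smul h₄.unit _⟩)
    (fun b y => ⟨((h₂.pow 2).unit⁻¹ • ((4 * q₁ - 1) • y.2.2.2 - (-(θ * (2 * b + 1)) • y.2.2.1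
        + (θ ^ 2 * b ^ 2 - 2 * q₂) • y.2.1 + (q₂ * θ * (2 * b - 1)) • y.1)), _, _, _), rfl, rfl,
      rfl, by
        have := smul_inv_smul (h₂.pow 2).unit ((4 * q₁ - 1) • y.2.2.2 -
          (-(θ * (2 * b + 1)) • y.2.2.1 + (θ ^ 2 * b ^ 2 - 2 * q₂) • y.2.1
            + (q₂ * θ * (2 * b - 1)) • y.1))
        rw [Units.smul_def (h₂.pow 2).unit, IsUnit.unit_spec] at this
        rw [this, add_sub_cancel]⟩)
    (w₀, w₁, w₂, w₃)
  have f₁ : ∀ b, (s b).2.2.2 = (s (b + 1)).2.2.1 := fun b => (hr b).2.2.1.symm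
  have f₂ : ∀ b, (s (b - 1)).2.2.1 = (s b).2.1 := fun b => by
    have := (hr (b - 1)).2.1
    rw [sub_add_cancel] at this
    exact this.symm
  have f₃ : ∀ b, (s (b - 1)).2.1 = (s b).1 := fun b => by
    have := (hr (b - 1)).1
    rw [sub_add_cancel] at this
    exact this.symm
  refine ⟨fun b => (s b).2.2.1, ⟨?_, ?_, ?_, ?_⟩, fun b => ?_⟩
  · change (s (0 - 1 - 1)).2.2.1 = _
    rw [f₂, f₃, hs]
  · change (s (0 - 1)).2.2.1 = _
    rw [f₂, hs]
  · simp only [hs]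
  · change (s (0 + 1)).2.2.1 = _
    rw [← f₁, hs]
  · have j₁ : b + 2 = b + 1 + 1 := by ring
    have j₂ : b - 2 = b - 1 - 1 := by ring
    simp only
    rw [j₁, j₂, f₂, f₂, f₃, ← f₁ (b + 1), (hr b).2.2.2, ← f₁ b]

/-- Columns `-1` and `0` generate all others through `rel₁`; the point is that `rel₂` then holds
everywhere as soon as column `0` obeys the recurrence. -/
theorem exists_solution {θ q₁ q₂ : A} (h2 : IsUnit (2 : A)) (h₁ : IsUnit q₁) (h₂ : IsUnit q₂)
    (h₄ : IsUnit (4 * q₁ - 1)) (w₀ w₁ w₂ w₃ : W) : ∃ π : ℤ × ℤ → W, IsSolution θ q₁ q₂ π ∧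
      π (0, -2) = w₀ ∧ π (0, -1) = w₁ ∧ π (0, 0) = w₂ ∧ π (0, 1) = w₃ := by
  obtain ⟨f, hf, hr⟩ := exists_recurrent_seq (θ := θ) h₂ h₄ w₀ w₁ w₂ w₃
  have cancel : ∀ {u : A} {x y : W}, IsUnit u → u • x = u • y → x = y := fun hu hxy =>
    hu.smul_left_cancel.1 hxy
  -- `c` is column `-1`. Its equation is forced by comparing `rel₁` on column `0` with `column_succ`
  -- there, shifted by two.
  obtain ⟨c, hc⟩ : ∃ c : ℤ → W, ∀ b : ℤ,
      (2 * q₁) • c b = (θ * (b - 2)) • f (b - 2) + q₂ • f (b - 3) - f (b - 1) :=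
    ⟨fun b => (h2.mul h₁).unit⁻¹ • ((θ * (b - 2)) • f (b - 2) + q₂ • f (b - 3) - f (b - 1)),
      fun b => smul_inv_smul (h2.mul h₁).unit _⟩
  -- The state at `a` is the pair of columns `a - 1` and `a`.
  obtain ⟨s, hs, hs'⟩ := exists_int_seq (X := (ℤ → W) × (ℤ → W))
    (fun a x y => y.1 = x.2 ∧ ∀ b, y.2 b = q₁ • x.1 (b + 2) + (θ * a) • x.2 b)
    (fun a x => ⟨(x.2, fun b => q₁ • x.1 (b + 2) + (θ * a) • x.2 b), rfl, fun _ => rfl⟩)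
    (fun a y => ⟨(fun b => h₁.unit⁻¹ • (y.2 (b - 2) - (θ * a) • y.1 (b - 2)), y.1), rfl,
      fun b => by
        have := smul_inv_smul h₁.unit (y.2 (b + 2 - 2) - (θ * a) • y.1 (b + 2 - 2))
        rw [Units.smul_def h₁.unit, IsUnit.unit_spec] at this
        simp only
        rw [this, add_sub_cancel_right, sub_add_cancel]⟩) (c, f)
  let col : ℤ → ℤ → W := fun a => (s a).2
  have col_pred : ∀ a, (s a).1 = col (a - 1) := fun a => by
    have := (hs' (a - 1)).1
    rwa [sub_add_cancel] at this
  have col0 : col 0 = f := by simp only [col, hs]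
  have col1 : col (-1) = c := by
    have := col_pred 0
    rw [hs, zero_sub] at this
    exact this.symm
  have r₁ : ∀ a b : ℤ, col (a + 1) b = q₁ • col (a - 1) (b + 2) + (θ * a) • col a b :=
    fun a b => by
      have := (hs' a).2 b
      rwa [col_pred] at this
  -- `P a` is the relation of `column_succ` on column `a`; given `rel₁`, it is equivalent to `rel₂`
  -- there.
  let P : ℤ → Prop := fun a => ∀ b : ℤ, (2 : A) • col (a + 1) b =
    (θ * (b + 2 * a)) • col a b + q₂ • col a (b - 1) - col a (b + 1)
  have P0 : P 0 := fun b => by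
    have := r₁ 0 b
    rw [zero_sub, col0, col1] at this
    have hcb := hc (b + 2)
    have j₁ : b + 2 - 2 = b := by ring
    have j₂ : b + 2 - 3 = b - 1 := by ring
    have j₃ : b + 2 - 1 = b + 1 := by ring
    rw [j₁, j₂, j₃] at hcb
    push_cast at hcb this
    rw [zero_add]
    rw [this, col0]
    push_cast
    linear_combination (norm := module) hcb
  -- After multiplication by `2q₁` and substitution of the definition of `c`, this is the recurrence
  -- at `b - 2`.
  have P1 : P (-1) := fun b => by
    rw [neg_add_cancel, col0, col1]
    refine cancel (h2.mul h₁) ?_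
    have e₁ := hc b
    have e₂ := hc (b - 1)
    have e₃ := hc (b + 1)
    have e₄ := hr (b - 2)
    have j₁ : b - 1 - 2 = b - 3 := by ring
    have j₂ : b - 1 - 3 = b - 4 := by ring
    have j₃ : b - 1 - 1 = b - 2 := by ring
    have j₄ : b + 1 - 2 = b - 1 := by ring
    have j₅ : b + 1 - 3 = b - 2 := by ring
    have j₆ : b - 2 + 1 = b - 1 := by ring
    have j₇ : b - 2 - 1 = b - 3 := by ring
    have j₈ : b - 2 - 2 = b - 4 := by ring
    simp only [add_sub_cancel_right, sub_add_cancel, j₁, j₂, j₃, j₄, j₅, j₆, j₇, j₈] at e₁ e₂ e₃ e₄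
    push_cast at e₁ e₂ e₃ e₄ ⊢
    linear_combination (norm := module)
      -(θ * (b - 2)) • e₁ - q₂ • e₂ + e₃ + e₄
  -- `rel₁` is a three-term rule in `a`, so `P` propagates from two neighbouring columns.
  have up : ∀ a, P a → P (a - 1) → P (a + 1) := fun a p p' b => by
    have e₁ := r₁ (a + 1) b
    have e₂ := r₁ a b
    have e₃ := r₁ a (b - 1)
    have e₄ := r₁ a (b + 1)
    have e₅ := p b
    have e₆ := p' (b + 2)
    have j₁ : b - 1 + 2 = b + 1 := by ring
    have j₂ : b + 1 + 2 = b + 3 := by ring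
    have j₃ : b + 2 + 1 = b + 3 := by ring
    have j₄ : b + 2 - 1 = b + 1 := by ring
    simp only [add_sub_cancel_right, sub_add_cancel, j₁, j₂, j₃, j₄] at e₁ e₂ e₃ e₄ e₅ e₆
    push_cast at e₁ e₂ e₃ e₄ e₅ e₆ ⊢
    linear_combination (norm := module) (2 : A) • e₁ - (θ * b + 2 * θ * a) • e₂ - q₂ • e₃ + e₄ +
      (θ * a) • e₅ + q₁ • e₆
  have down : ∀ a, P a → P (a + 1) → P (a - 1) := fun a p p' b => by
    refine cancel h₁ ?_
    have e₁ := r₁ (a + 1) (b - 2)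
    have e₂ := r₁ a (b - 2)
    have e₃ := r₁ a (b - 3)
    have e₄ := r₁ a (b - 1)
    have e₅ := p (b - 2)
    have e₆ := p' (b - 2)
    have j₁ : b - 3 + 2 = b - 1 := by ring
    have j₂ : b - 1 + 2 = b + 1 := by ring
    have j₃ : b - 2 + 1 = b - 1 := by ring
    have j₄ : b - 2 - 1 = b - 3 := by ring
    simp only [add_sub_cancel_right, sub_add_cancel, j₁, j₂, j₃, j₄] at e₁ e₂ e₃ e₄ e₅ e₆ ⊢
    push_cast at e₁ e₂ e₃ e₄ e₅ e₆ ⊢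
    linear_combination (norm := module) -(2 : A) • e₁ + (θ * b + 2 * θ * a - 2 * θ) • e₂ + q₂ • e₃
      - e₄ - (θ * a) • e₅ + e₆
  have hP : ∀ a, P a ∧ P (a - 1) := fun a => by
    induction a using Int.induction_on with
    | zero => exact ⟨P0, P1⟩
    | succ a ih => exact ⟨up _ ih.1 ih.2, by simpa using ih.1⟩
    | pred a ih => exact ⟨ih.2, down _ ih.2 (by simpa using ih.1)⟩
  refine ⟨fun m => col m.1 m.2, ⟨r₁, fun a b => ?_⟩, ?_⟩
  · have e₁ := (hP a).1 b
    have e₂ := r₁ a b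
    linear_combination (norm := module) e₁ - (2 : A) • e₂
  · simp only [col0]
    exact hf
end Solutions
end QDS

namespace QDS

/-! ### From the lattice system to the basis `ω` -/

section Basis

variable {A W : Type*} [CommRing A] [AddCommGroup W] [Module A W]

/-- The classes of the forms `ωᵢ` in terms of the classes of the monomials. -/
def omegaOf (q₁ q₂ : A) (π : ℤ × ℤ → W) : Fin 4 → W :=
  ![π (0, 0), q₂ • π (0, -1), (q₁ * q₂) • π (-1, 1), q₁ • π (-1, 2)]

theorem map_omegaFun (q₁ q₂ : A) (p : TorusFun A →ₗ[A] W) (i : Fin 4) :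
    p (omegaFun q₁ q₂ i) = omegaOf q₁ q₂ (fun m => p (.single m 1)) i := by
  have hp : ∀ m c, p (.single m c) = c • p (.single m 1) := fun m c => by
    rw [← map_smul, AddMonoidAlgebra.smul_single, smul_eq_mul, mul_one]
  fin_cases i <;> simp [omegaFun, omegaOf, ← hp]

namespace IsSolution

variable {θ q₁ q₂ : A} {π : ℤ × ℤ → W}

theorem eval_zero_one (h : IsSolution θ q₁ q₂ π) :
    π (0, 1) = omegaOf q₁ q₂ π 1 - (2 : A) • omegaOf q₁ q₂ π 3 := by
  have e := h.rel₂ 0 0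
  simp only [zero_add, zero_sub] at e
  push_cast at e
  simp only [omegaOf, Matrix.cons_val]
  linear_combination (norm := module) e

theorem eval_zero_neg_two (h : IsSolution θ q₁ q₂ π) :
    q₂ ^ 2 • π (0, -2) = (2 : A) • omegaOf q₁ q₂ π 2 + θ • omegaOf q₁ q₂ π 1
      + q₂ • omegaOf q₁ q₂ π 0 := by
  have e := h.rel₂ 0 (-1)
  have j : (-1 : ℤ) + 2 = 1 := rfl
  have j' : (-1 : ℤ) - 1 = -2 := rfl
  simp only [zero_sub, neg_add_cancel, j, j'] at e
  push_cast at e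
  simp only [omegaOf, Matrix.cons_val]
  linear_combination (norm := module) -q₂ • e

theorem span_omegaOf (h : IsSolution θ q₁ q₂ π) (h2 : IsUnit (2 : A)) (h₁ : IsUnit q₁)
    (h₂ : IsUnit q₂) (h₄ : IsUnit (4 * q₁ - 1)) (m : ℤ × ℤ) :
    π m ∈ Submodule.span A (Set.range (omegaOf q₁ q₂ π)) := by
  set N := Submodule.span A (Set.range (omegaOf q₁ q₂ π))
  have hN : ∀ i, omegaOf q₁ q₂ π i ∈ N := fun i => Submodule.subset_span ⟨i, rfl⟩
  refine h.mem_of_mem h2 h₁ h₂ h₄ N ?_ ?_ (hN 0) ?_ m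
  · rw [← Submodule.smul_mem_iff_of_isUnit N (h₂.pow 2), h.eval_zero_neg_two]
    exact N.add_mem (N.add_mem (N.smul_mem _ (hN _)) (N.smul_mem _ (hN _))) (N.smul_mem _ (hN _))
  · exact (Submodule.smul_mem_iff_of_isUnit N h₂).1 (hN 1)
  · rw [h.eval_zero_one]
    exact N.sub_mem (hN _) (N.smul_mem _ (hN _))

end IsSolution

/-- The prescribed values on column `0` are those that `eval_zero_one` and `eval_zero_neg_two`
impose. These two identities then recover `w 3` and `w 2` after cancelling `2`. -/
theorem exists_solution_omegaOf {θ q₁ q₂ : A} (h2 : IsUnit (2 : A)) (h₁ : IsUnit q₁)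
    (h₂ : IsUnit q₂) (h₄ : IsUnit (4 * q₁ - 1)) (w : Fin 4 → W) :
    ∃ π : ℤ × ℤ → W, IsSolution θ q₁ q₂ π ∧ omegaOf q₁ q₂ π = w := by
  have cancel : ∀ {u : A} {x y : W}, IsUnit u → u • x = u • y → x = y := fun hu hxy =>
    hu.smul_left_cancel.1 hxy
  obtain ⟨π, h, p₂, p₁, p₀, p₃⟩ := exists_solution (θ := θ) h2 h₁ h₂ h₄
    ((h₂.pow 2).unit⁻¹ • ((2 : A) • w 2 + θ • w 1 + q₂ • w 0)) (h₂.unit⁻¹ • w 1) (w 0)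
    (w 1 - (2 : A) • w 3)
  have e₀ : omegaOf q₁ q₂ π 0 = w 0 := p₀
  have e₁ : omegaOf q₁ q₂ π 1 = w 1 := by
    change q₂ • π (0, -1) = w 1
    rw [p₁]
    exact smul_inv_smul h₂.unit _
  have e₃ : omegaOf q₁ q₂ π 3 = w 3 := by
    have := h.eval_zero_one
    rw [p₃, e₁] at this
    exact (cancel h2 (sub_right_injective this)).symm
  have e₂ : omegaOf q₁ q₂ π 2 = w 2 := by
    have := h.eval_zero_neg_two
    have e := smul_inv_smul (h₂.pow 2).unit ((2 : A) • w 2 + θ • w 1 + q₂ • w 0)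
    rw [← p₂, Units.smul_def, IsUnit.unit_spec] at e
    rw [e, e₁, e₀] at this
    exact (cancel h2 (add_right_cancel (add_right_cancel this))).symm
  refine ⟨π, h, funext fun i => ?_⟩
  fin_cases i
  exacts [e₀, e₁, e₂, e₃]

/-- A solution with values in `A⁴` whose `ωᵢ` are the standard basis vectors induces a map `ψ` on
the quotient, which proves independence; generation is `span_omegaOf`. -/
theorem exists_basis_omegaFun {θ q₁ q₂ : A} (h2 : IsUnit (2 : A)) (h₁ : IsUnit q₁)
    (h₂ : IsUnit q₂) (h₄ : IsUnit (4 * q₁ - 1)) (p : TorusFun A →ₗ[A] W)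
    (hp : Function.Surjective p)
    (hk : LinearMap.ker p = LinearMap.range (twistedD θ (F q₁ q₂))) :
    ∃ b : Module.Basis (Fin 4) A W, ∀ i, b i = p (omegaFun q₁ q₂ i) := by
  have hs := (range_twistedD_le_ker_iff θ q₁ q₂ p).1 hk.ge
  obtain ⟨π, hπ, hω⟩ := exists_solution_omegaOf (θ := θ) h2 h₁ h₂ h₄ (Pi.basisFun A (Fin 4))
  obtain ⟨ℓ, hℓ⟩ : ∃ ℓ : TorusFun A →ₗ[A] (Fin 4 → A), ∀ m, ℓ (.single m 1) = π m :=
    ⟨Finsupp.linearCombination A π ∘ₗ (AddMonoidAlgebra.coeffLinearEquiv A).toLinearMap,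
      fun m => by simp⟩
  have hker : LinearMap.ker p ≤ LinearMap.ker ℓ := by
    rw [hk, range_twistedD_le_ker_iff]
    simpa only [hℓ] using hπ
  let ψ : W →ₗ[A] (Fin 4 → A) := (LinearMap.ker p).liftQ ℓ hker ∘ₗ
    (p.quotKerEquivOfSurjective hp).symm.toLinearMap
  have hψ : ∀ x, ψ (p x) = ℓ x := fun x => by
    have : (p.quotKerEquivOfSurjective hp).symm (p x) = (LinearMap.ker p).mkQ x := by
      rw [LinearEquiv.symm_apply_eq]
      rfl
    simp only [ψ, LinearMap.comp_apply, LinearEquiv.coe_coe, this]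
    rfl
  have hb : (ψ ∘ fun i => p (omegaFun q₁ q₂ i)) = Pi.basisFun A (Fin 4) := funext fun i => by
    rw [Function.comp_apply, hψ, map_omegaFun, ← hω]
    simp only [hℓ]
  refine ⟨Module.Basis.mk (v := fun i => p (omegaFun q₁ q₂ i)) ?_ ?_, fun i => Module.Basis.mk_apply _ _ i⟩
  · exact LinearIndependent.of_comp ψ (hb ▸ (Pi.basisFun A (Fin 4)).linearIndependent)
  · rintro x -
    obtain ⟨g, rfl⟩ := hp x
    simp only [map_omegaFun]
    induction g using AddMonoidAlgebra.induction_linear with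
    | zero => simp
    | add f g hf hg => rw [map_add]; exact add_mem hf hg
    | single m c =>
      have : (.single m c : TorusFun A) = c • .single m 1 := by
        rw [AddMonoidAlgebra.smul_single, smul_eq_mul, mul_one]
      rw [this, map_smul]
      exact Submodule.smul_mem _ _ (hs.span_omegaOf h2 h₁ h₂ h₄ m)

end Basis

/-! ### The Brieskorn module inside the Gauss–Manin system -/

section Applications

variable {R : Type*} [CommRing R]

theorem baseChange_F {A : Type*} [CommRing A] [Algebra R A] (q₁ q₂ : R) :
    (F q₁ q₂).baseChange A = F (algebraMap R A q₁) (algebraMap R A q₂) := by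
  simp [F, TorusFun.baseChange, map_add]

theorem baseChange_omegaFun {A : Type*} [CommRing A] [Algebra R A] (q₁ q₂ : R) (i : Fin 4) :
    (omegaFun q₁ q₂ i).baseChange A = omegaFun (algebraMap R A q₁) (algebraMap R A q₂) i := by
  fin_cases i <;> simp [omegaFun, TorusFun.baseChange]

theorem isUnit_two_of_algebra {A : Type*} [CommRing A] [Algebra R A] (h : IsUnit (2 : R)) :
    IsUnit (2 : A) := by
  simpa only [map_ofNat] using h.map (algebraMap R A)

theorem isUnit_four_mul_sub_one_of_algebra {A : Type*} [CommRing A] [Algebra R A] {q₁ : R}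
    (h : IsUnit (4 * q₁ - 1)) : IsUnit (4 * algebraMap R A q₁ - 1) := by
  simpa only [map_sub, map_mul, map_ofNat, map_one] using h.map (algebraMap R A)

variable {q₁ q₂ : R}

theorem exists_basis_omega (h2 : IsUnit (2 : R)) (h₁ : IsUnit q₁) (h₂ : IsUnit q₂)
    (h₄ : IsUnit (4 * q₁ - 1)) :
    ∃ b : Module.Basis (Fin 4) (chartZero R) (BrieskornModule (F q₁ q₂)),
      ∀ i, b i = omega q₁ q₂ i := by
  simp only [omega, baseChange_omegaFun]
  refine exists_basis_omegaFun (θ := theta R) ?_ (h₁.map _) (h₂.map _) ?_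
    (BrieskornModule.mk (F q₁ q₂)) (Submodule.mkQ_surjective _) ?_
  · exact isUnit_two_of_algebra h2
  · exact isUnit_four_mul_sub_one_of_algebra h₄
  · rw [← baseChange_F]
    exact Submodule.ker_mkQ _

theorem twistedD_phase (F : TorusFun R) (η : TorusFun R[T;T⁻¹] × TorusFun R[T;T⁻¹]) :
    twistedD (LaurentPolynomial.T 1) (F.baseChange R[T;T⁻¹]) η =
      twistedD 1 (phase F) ((LaurentPolynomial.T 1 : R[T;T⁻¹]) • η) := by
  have hT : (LaurentPolynomial.T (-1) : R[T;T⁻¹]) * LaurentPolynomial.T 1 = 1 := by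
    rw [← LaurentPolynomial.T_add, neg_add_cancel, LaurentPolynomial.T_zero]
  simp only [twistedD_apply, phase, Prod.smul_fst, Prod.smul_snd, Derivation.map_smul,
    smul_mul_smul_comm, hT, one_smul, smul_sub]

/-- The operators `d - θ⁻¹dF∧` and `θd - dF∧` differ by rescaling 1-forms by the unit `θ`. -/
theorem range_twistedD_phase (F : TorusFun R) :
    LinearMap.range (twistedD 1 (phase F)) =
      LinearMap.range (twistedD (LaurentPolynomial.T 1) (F.baseChange R[T;T⁻¹])) := by
  apply le_antisymm
  · rintro _ ⟨η, rfl⟩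
    refine ⟨(LaurentPolynomial.T (-1) : R[T;T⁻¹]) • η, ?_⟩
    rw [twistedD_phase, smul_smul, ← LaurentPolynomial.T_add, add_neg_cancel,
      LaurentPolynomial.T_zero, one_smul]
  · rintro _ ⟨η, rfl⟩
    exact ⟨_, (twistedD_phase F η).symm⟩

theorem omegaGM_eq_mk (q₁ q₂ : R) (i : Fin 4) : omegaGM q₁ q₂ i = GaussManin.mk (F q₁ q₂)
    (omegaFun (algebraMap R R[T;T⁻¹] q₁) (algebraMap R R[T;T⁻¹] q₂) i) := by
  change GaussManin.mk (F q₁ q₂) (TorusFun.baseChange _ (TorusFun.baseChange _ _)) = _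
  rw [baseChange_omegaFun, baseChange_omegaFun]
  rfl

theorem ker_gaussManinMk (q₁ q₂ : R) : LinearMap.ker (GaussManin.mk (F q₁ q₂)) =
    LinearMap.range (twistedD (LaurentPolynomial.T 1)
      (F (algebraMap R R[T;T⁻¹] q₁) (algebraMap R R[T;T⁻¹] q₂))) := by
  rw [← baseChange_F, ← range_twistedD_phase]
  exact Submodule.ker_mkQ _

theorem exists_basis_omegaGM (h2 : IsUnit (2 : R)) (h₁ : IsUnit q₁) (h₂ : IsUnit q₂)
    (h₄ : IsUnit (4 * q₁ - 1)) :
    ∃ b : Module.Basis (Fin 4) R[T;T⁻¹] (GaussManin (F q₁ q₂)), ∀ i, b i = omegaGM q₁ q₂ i := by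
  simp only [omegaGM_eq_mk]
  refine exists_basis_omegaFun ?_ (h₁.map _) (h₂.map _) ?_ _ (GaussManin.mk_surjective _)
    (ker_gaussManinMk q₁ q₂)
  · exact isUnit_two_of_algebra h2
  · exact isUnit_four_mul_sub_one_of_algebra h₄

/-- An `R[θ]`-basis is sent to an `R[θ, θ⁻¹]`-basis, and the coefficient rings embed. -/
theorem toGaussManin_injective (h2 : IsUnit (2 : R)) (h₁ : IsUnit q₁) (h₂ : IsUnit q₂)
    (h₄ : IsUnit (4 * q₁ - 1)) : Function.Injective (toGaussManin (F q₁ q₂)) := by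
  obtain ⟨b, hb⟩ := exists_basis_omega h2 h₁ h₂ h₄
  obtain ⟨b', hb'⟩ := exists_basis_omegaGM h2 h₁ h₂ h₄
  refine (injective_iff_map_eq_zero _).2 fun x hx => ?_
  have hsum : toGaussManin (F q₁ q₂) x = ∑ i, (b.repr x i : R[T;T⁻¹]) • b' i := by
    conv_lhs => rw [← b.sum_repr x, map_sum]
    refine Finset.sum_congr rfl fun i _ => ?_
    rw [map_smul, hb, hb']
    rfl
  rw [hsum] at hx
  have := Fintype.linearIndependent_iff.1 b'.linearIndependent _ hx
  rw [← b.sum_repr x]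
  refine Finset.sum_eq_zero fun i _ => ?_
  have hi : b.repr x i = 0 := Subtype.ext (this i)
  rw [hi, zero_smul]

theorem brieskornLattice_eq_span (h2 : IsUnit (2 : R)) (h₁ : IsUnit q₁) (h₂ : IsUnit q₂)
    (h₄ : IsUnit (4 * q₁ - 1)) :
    brieskornLattice (F q₁ q₂) = Submodule.span (chartZero R) (Set.range (omegaGM q₁ q₂)) := by
  obtain ⟨b, hb⟩ := exists_basis_omega h2 h₁ h₂ h₄
  rw [brieskornLattice, LinearMap.range_eq_map, ← b.span_eq, Submodule.map_span, ← Set.range_comp]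
  congr 2
  ext1 i
  rw [Function.comp_apply, hb]
  rfl

end Applications
end QDS

namespace QDS

/-! ### The involution `j` and derivations on the two charts -/

section Line

open LaurentPolynomial

variable {R : Type*} [CommRing R]

theorem negTheta_T_neg_one : negTheta R (T (-1)) = -T (-1) := by
  have h : T (-1) * (T 1 : R[T;T⁻¹]) = 1 := by rw [← T_add, neg_add_cancel, T_zero]
  have h' := congrArg (negTheta R) h
  rw [map_mul, negTheta_T_one, map_one] at h'
  calc negTheta R (T (-1)) = negTheta R (T (-1)) * (T (-1) * T 1) := by rw [h, mul_one]
    _ = -(T (-1) * (negTheta R (T (-1)) * -T 1)) := by ring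
    _ = _ := by rw [h', mul_one]

theorem negTheta_T_eq_or_eq_neg (n : ℤ) : negTheta R (T n) = T n ∨ negTheta R (T n) = -T n := by
  induction n using Int.induction_on with
  | zero => simp
  | succ n ih =>
    rw [T_add, map_mul, negTheta_T_one]
    rcases ih with ih | ih <;>
      simp only [ih, mul_neg, neg_mul, neg_neg, true_or, or_true]
  | pred n ih =>
    rw [sub_eq_add_neg, T_add, map_mul, negTheta_T_neg_one]
    rcases ih with ih | ih <;>
      simp only [ih, mul_neg, neg_mul, neg_neg, true_or, or_true]

theorem negTheta_negTheta (x : R[T;T⁻¹]) : negTheta R (negTheta R x) = x := by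
  induction x using LaurentPolynomial.induction_on' with
  | add p q hp hq => rw [map_add, map_add, hp, hq]
  | C_mul_T n a =>
    rcases negTheta_T_eq_or_eq_neg (R := R) n with h | h <;>
      simp only [map_mul, negTheta_C, h, map_neg, neg_neg]

theorem liftDer_T {k : Type*} [CommRing k] [Algebra k R] (X : Derivation k R R) (n : ℤ) :
    liftDer X (T n) = 0 :=
  (coeffDer_single X n 1).trans (by rw [X.map_one_eq_zero]; exact AddMonoidAlgebra.single_zero n)

theorem liftDer_C {k : Type*} [CommRing k] [Algebra k R] (X : Derivation k R R) (r : R) :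
    liftDer X (C r) = C (X r) :=
  coeffDer_single X 0 r

theorem thetaDer_T {k : Type*} [CommRing k] [Algebra k R] (n : ℤ) :
    thetaDer R k (T n) = C (n : R) * T n :=
  (weightDer_single (AddMonoidHom.id ℤ) n (1 : R)).trans <| by
    rw [mul_one]
    exact single_eq_C_mul_T _ _

theorem thetaDer_C {k : Type*} [CommRing k] [Algebra k R] (r : R) :
    thetaDer R k (C r) = 0 :=
  (weightDer_single (AddMonoidHom.id ℤ) 0 r).trans <| by
    rw [map_zero, Int.cast_zero, zero_mul]
    exact AddMonoidAlgebra.single_zero 0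

/-- Such a derivation preserves the degree in `θ`, and `j` acts on each degree by a sign. -/
theorem derivation_negTheta {k : Type*} [CommRing k] [Algebra k R]
    (δ : Derivation k R[T;T⁻¹] R[T;T⁻¹]) (hC : ∀ r, ∃ s, δ (C r) = C s)
    (hT : ∀ n : ℤ, ∃ s, δ (T n) = C s * T n) (x : R[T;T⁻¹]) :
    δ (negTheta R x) = negTheta R (δ x) := by
  induction x using LaurentPolynomial.induction_on' with
  | add p q hp hq => rw [map_add, map_add, map_add, hp, hq, map_add]
  | C_mul_T n a =>
    obtain ⟨s, hs⟩ := hC a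
    obtain ⟨t, ht⟩ := hT n
    rcases negTheta_T_eq_or_eq_neg (R := R) n with h | h <;>
      simp only [map_mul, negTheta_C, h, Derivation.leibniz, map_neg, hs, ht, smul_eq_mul, map_add,
        mul_neg, neg_mul, neg_add]

theorem liftDer_negTheta {k : Type*} [CommRing k] [Algebra k R] (X : Derivation k R R)
    (x : R[T;T⁻¹]) : liftDer X (negTheta R x) = negTheta R (liftDer X x) :=
  derivation_negTheta _ (fun r => ⟨X r, liftDer_C X r⟩)
    (fun n => ⟨0, by rw [liftDer_T, map_zero, zero_mul]⟩) x

theorem thetaDer_negTheta {k : Type*} [CommRing k] [Algebra k R] (x : R[T;T⁻¹]) :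
    thetaDer R k (negTheta R x) = negTheta R (thetaDer R k x) :=
  derivation_negTheta _ (fun r => ⟨0, by rw [thetaDer_C, map_zero]⟩)
    (fun n => ⟨(n : R), thetaDer_T n⟩) x

theorem derivation_mem_adjoin {k : Type*} [CommRing k] [Algebra k R]
    (δ : Derivation k R[T;T⁻¹] R[T;T⁻¹]) (hC : ∀ r, ∃ s, δ (C r) = C s)
    (hT : ∀ n : ℤ, ∃ s, δ (T n) = C s * T n) (n : ℤ) {x : R[T;T⁻¹]}
    (hx : x ∈ Algebra.adjoin R {(T n : R[T;T⁻¹])}) :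
    δ x ∈ Algebra.adjoin R {(T n : R[T;T⁻¹])} := by
  induction hx using Algebra.adjoin_induction with
  | mem x hx =>
    obtain rfl := hx
    obtain ⟨s, hs⟩ := hT n
    rw [hs]
    exact mul_mem (Subalgebra.algebraMap_mem _ s) (Algebra.subset_adjoin rfl)
  | algebraMap r =>
    obtain ⟨s, hs⟩ := hC r
    have : δ (algebraMap R _ r) = algebraMap R _ s := hs
    rw [this]
    exact Subalgebra.algebraMap_mem _ s
  | add x y _ _ hx hy => rw [map_add]; exact add_mem hx hy
  | mul x y hx' hy' hx hy =>
    rw [Derivation.leibniz]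
    exact add_mem (mul_mem hx' hy) (mul_mem hy' hx)

theorem liftDer_mem_adjoin {k : Type*} [CommRing k] [Algebra k R] (X : Derivation k R R) (n : ℤ)
    {x : R[T;T⁻¹]} (hx : x ∈ Algebra.adjoin R {(T n : R[T;T⁻¹])}) :
    liftDer X x ∈ Algebra.adjoin R {(T n : R[T;T⁻¹])} :=
  derivation_mem_adjoin _ (fun r => ⟨X r, liftDer_C X r⟩)
    (fun n => ⟨0, by rw [liftDer_T, map_zero, zero_mul]⟩) n hx

theorem thetaDer_mem_adjoin {k : Type*} [CommRing k] [Algebra k R] (n : ℤ)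
    {x : R[T;T⁻¹]} (hx : x ∈ Algebra.adjoin R {(T n : R[T;T⁻¹])}) :
    thetaDer R k x ∈ Algebra.adjoin R {(T n : R[T;T⁻¹])} :=
  derivation_mem_adjoin _ (fun r => ⟨0, by rw [thetaDer_C, map_zero]⟩)
    (fun n => ⟨(n : R), thetaDer_T n⟩) n hx

theorem negTheta_mem_adjoin (n : ℤ) {x : R[T;T⁻¹]}
    (hx : x ∈ Algebra.adjoin R {(T n : R[T;T⁻¹])}) :
    negTheta R x ∈ Algebra.adjoin R {(T n : R[T;T⁻¹])} := by
  induction hx using Algebra.adjoin_induction with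
  | mem x hx =>
    obtain rfl := hx
    rcases negTheta_T_eq_or_eq_neg (R := R) n with h | h <;> rw [h]
    exacts [Algebra.subset_adjoin rfl, neg_mem (Algebra.subset_adjoin rfl)]
  | algebraMap r =>
    have : negTheta R (algebraMap R _ r) = algebraMap R _ r := negTheta_C R r
    rw [this]
    exact Subalgebra.algebraMap_mem _ r
  | add x y _ _ hx hy => rw [map_add]; exact add_mem hx hy
  | mul x y _ _ hx hy => rw [map_mul]; exact mul_mem hx hy

end Line

/-! ### Matrix criterion for a quantum differential system -/

section Criterion

open LaurentPolynomial Matrix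

variable {R G : Type*} [CommRing R] [AddCommGroup G] [Module R[T;T⁻¹] G] {r : ℕ}
  (b : Module.Basis (Fin r) R[T;T⁻¹] G) (g : Matrix (Fin r) (Fin r) R) (d : ℤ)

/-- The sesquilinear form with Gram matrix `θᵈ g`. -/
noncomputable def sesqForm : G →ₗ[R[T;T⁻¹]] G →ₛₗ[negTheta R] R[T;T⁻¹] :=
  LinearMap.mk₂'ₛₗ (RingHom.id _) (negTheta R)
    (fun m n => T d * (b.repr m ⬝ᵥ g.map C *ᵥ fun j => negTheta R (b.repr n j)))
    (fun m m' n => by simp [add_dotProduct, mul_add])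
    (fun c m n => by simp [smul_dotProduct, mul_left_comm])
    (fun m n n' => by
      have : (fun j => negTheta R (b.repr (n + n') j)) =
        (fun j => negTheta R (b.repr n j)) + fun j => negTheta R (b.repr n' j) := by
        ext1 j; simp
      rw [this, mulVec_add, dotProduct_add, mul_add])
    (fun c m n => by
      have : (fun j => negTheta R (b.repr (c • n) j)) =
        negTheta R c • fun j => negTheta R (b.repr n j) := by
        ext1 j; simp
      rw [this, mulVec_smul, dotProduct_smul, smul_eq_mul, smul_eq_mul, mul_left_comm])

theorem sesqForm_apply (m n : G) : sesqForm b g d m n =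
    T d * (b.repr m ⬝ᵥ g.map C *ᵥ fun j => negTheta R (b.repr n j)) := rfl

theorem sesqForm_basis_left (i : Fin r) (n : G) : sesqForm b g d (b i) n =
    T d * (g.map C *ᵥ fun j => negTheta R (b.repr n j)) i := by
  rw [sesqForm_apply, b.repr_self, Finsupp.single_eq_pi_single, single_one_dotProduct]

theorem sesqForm_basis (i j : Fin r) : sesqForm b g d (b i) (b j) = C (g i j) * T d := by
  have : (fun k => negTheta R (b.repr (b j) k)) = Pi.single j 1 := by
    ext1 k
    rw [b.repr_self, Finsupp.single_eq_pi_single]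
    by_cases h : k = j
    · subst h; simp
    · simp [h]
  rw [sesqForm_basis_left, this, mulVec_single_one, mul_comm]
  rfl

variable {b g d}

theorem mem_span_basis_iff (A : Subalgebra R R[T;T⁻¹]) (m : G) :
    m ∈ Submodule.span A (Set.range b) ↔ ∀ i, b.repr m i ∈ A := by
  constructor
  · intro hm i
    induction hm using Submodule.span_induction with
    | mem x hx =>
      obtain ⟨j, rfl⟩ := hx
      rw [b.repr_self, Finsupp.single_apply]
      split_ifs
      exacts [one_mem _, zero_mem _]
    | zero => simp
    | add x y _ _ hx hy => rw [map_add]; exact add_mem hx hy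
    | smul a x _ hx =>
      change b.repr ((a : R[T;T⁻¹]) • x) i ∈ A
      rw [map_smul]
      exact mul_mem a.2 hx
  · intro h
    rw [← b.sum_repr m]
    exact sum_mem fun i _ => Submodule.smul_mem _ (⟨_, h i⟩ : A) (Submodule.subset_span ⟨i, rfl⟩)

/-- A linear form with coordinate vector `c` is represented by the vector with coordinates
`j(g⁻¹c)`, which stays over `A` since `g⁻¹` has entries in `R` and `j` preserves `A`. -/
theorem isPerfectOn_sesqForm (hg : IsUnit g.det) (A : Subalgebra R R[T;T⁻¹])
    (hA : ∀ a ∈ A, negTheta R a ∈ A) :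
    IsPerfectOn A (Submodule.span A (Set.range b)) (sesqForm b g d) d := by
  have hmul : ∀ (g : Matrix (Fin r) (Fin r) R) (v : Fin r → R[T;T⁻¹]), (∀ j, v j ∈ A) →
      ∀ i, (g.map C *ᵥ v) i ∈ A := fun g v hv i =>
    show ∑ j, C (g i j) * v j ∈ A from
      sum_mem fun j _ => mul_mem (A.algebraMap_mem (g i j)) (hv j)
  have hgg : g⁻¹.map C * g.map (C : R →+* R[T;T⁻¹]) = 1 := by
    rw [← Matrix.map_mul, nonsing_inv_mul _ hg]
    exact Matrix.map_one _ (map_zero _) (map_one _)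
  have hgg' : g.map (C : R →+* R[T;T⁻¹]) * g⁻¹.map C = 1 := by
    rw [← Matrix.map_mul, mul_nonsing_inv _ hg]
    exact Matrix.map_one _ (map_zero _) (map_one _)
  have hT : (T (-d) : R[T;T⁻¹]) * T d = 1 := by rw [← T_add, neg_add_cancel, T_zero]
  refine ⟨fun m hm n hn => ⟨_, ?_, rfl⟩, fun φ => ?_⟩
  · rw [mem_span_basis_iff] at hm hn
    exact sum_mem fun i _ => mul_mem (hm i) (hmul g _ (fun j => hA _ (hn j)) i)
  · let c : Fin r → R[T;T⁻¹] := fun i => φ ⟨b i, Submodule.subset_span ⟨i, rfl⟩⟩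
    have hc : ∀ i, c i ∈ A := fun i => (φ ⟨b i, Submodule.subset_span ⟨i, rfl⟩⟩).2
    have hφ : ∀ m : Submodule.span A (Set.range b), (φ m : R[T;T⁻¹]) = b.repr m ⬝ᵥ c := by
      rintro ⟨m, hm⟩
      have hm' := (mem_span_basis_iff A m).1 hm
      have : (⟨m, hm⟩ : Submodule.span A (Set.range b)) = ∑ i, (⟨b.repr m i, hm' i⟩ : A) •
          (⟨b i, Submodule.subset_span ⟨i, rfl⟩⟩ : Submodule.span A (Set.range b)) := by
        apply Subtype.ext
        rw [AddSubmonoidClass.coe_finsetSum]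
        exact (b.sum_repr m).symm
      conv_lhs => rw [this, map_sum]
      rw [AddSubmonoidClass.coe_finsetSum]
      refine Finset.sum_congr rfl fun i _ => ?_
      rw [map_smul]
      rfl
    let v : Fin r → R[T;T⁻¹] := g⁻¹.map C *ᵥ c
    have hv : ∀ i, v i ∈ A := hmul _ _ hc
    let n : G := b.equivFun.symm fun j => negTheta R (v j)
    have hn : ∀ j, b.repr n j = negTheta R (v j) := fun j => by
      rw [← b.equivFun_apply, LinearEquiv.apply_symm_apply]
    refine ⟨⟨n, (mem_span_basis_iff A n).2 fun i => by rw [hn]; exact hA _ (hv i)⟩, fun m => ?_, ?_⟩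
    · simp only [sesqForm_apply, hn, negTheta_negTheta, hφ]
      change T d * (_ ⬝ᵥ _ *ᵥ v) = _
      rw [mulVec_mulVec, hgg', one_mulVec]
    · rintro ⟨n', hn'⟩ h
      apply Subtype.ext
      apply b.repr.injective
      ext1 j
      change b.repr n' j = b.repr n j
      have hw : (g.map C *ᵥ fun j => negTheta R (b.repr n' j)) = c := funext fun i => by
        have := h ⟨b i, Submodule.subset_span ⟨i, rfl⟩⟩
        rw [sesqForm_basis_left] at this
        have := congrArg (T (-d) * ·) this
        simp only [← mul_assoc, hT, one_mul] at this
        exact this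
      have hw' : (fun j => negTheta R (b.repr n' j)) = v := by
        simp only [v]
        rw [← hw, mulVec_mulVec, hgg, one_mulVec]
      rw [hn, ← hw', negTheta_negTheta]

variable {k : Type*} [CommRing k] [Algebra k R] {nabla : Connection k R[T;T⁻¹] G}

theorem smul_cov_mem_span (A : Subalgebra R R[T;T⁻¹]) (δ : Derivation k R[T;T⁻¹] R[T;T⁻¹])
    (hδ : ∀ a ∈ A, δ a ∈ A) {t : R[T;T⁻¹]} (ht : t ∈ A)
    (h : ∀ i, t • nabla.cov δ (b i) ∈ Submodule.span A (Set.range b)) (m : G)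
    (hm : m ∈ Submodule.span A (Set.range b)) :
    t • nabla.cov δ m ∈ Submodule.span A (Set.range b) := by
  induction hm using Submodule.span_induction with
  | mem x hx => obtain ⟨i, rfl⟩ := hx; exact h i
  | zero => simp
  | add x y _ _ hx hy => rw [map_add, smul_add]; exact add_mem hx hy
  | smul a x hx' hx =>
    have : t • nabla.cov δ (a • x) =
        (⟨t * δ a, mul_mem ht (hδ a a.2)⟩ : A) • x + a • (t • nabla.cov δ x) := by
      change t • nabla.cov δ ((a : R[T;T⁻¹]) • x) =
        (t * δ a) • x + (a : R[T;T⁻¹]) • (t • nabla.cov δ x)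
      rw [nabla.leibniz, smul_add, smul_smul, smul_comm]
    rw [this]
    exact add_mem (Submodule.smul_mem _ _ hx') (Submodule.smul_mem _ _ hx)

/-- Leibniz reduces flatness to basis vectors. There the part in `θᵈ` is `hP`, while in the part in
`θᵈ⁻¹` the involution reverses the sign of the second argument, leaving `Qᵀg - gQ = 0`. -/
theorem sesqForm_flat (δ : Derivation k R[T;T⁻¹] R[T;T⁻¹])
    (hδ : ∀ a, δ (negTheta R a) = negTheta R (δ a)) {P Q : Matrix (Fin r) (Fin r) R}
    (hcov : ∀ j, nabla.cov δ (b j) = ∑ i, (C (P i j) + T (-1) * C (Q i j)) • b i)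
    (hP : ∀ i j, δ (C (g i j) * T d) = C ((Pᵀ * g + g * P) i j) * T d)
    (hQ : Qᵀ * g = g * Q) (m n : G) :
    δ (sesqForm b g d m n) =
      sesqForm b g d (nabla.cov δ m) n + sesqForm b g d m (nabla.cov δ n) := by
  have hm : m ∈ Submodule.span R[T;T⁻¹] (Set.range b) := b.mem_span m
  have hn : n ∈ Submodule.span R[T;T⁻¹] (Set.range b) := b.mem_span n
  induction hm using Submodule.span_induction with
  | zero => simp
  | add x y _ _ hx hy =>
    simp only [map_add, LinearMap.add_apply, hx, hy]
    abel
  | smul a x _ hx =>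
    simp only [map_add, map_smul, LinearMap.add_apply, LinearMap.smul_apply, nabla.leibniz,
      smul_eq_mul, Derivation.leibniz, hx]
    ring
  | mem x hx =>
    obtain ⟨i, rfl⟩ := hx
    induction hn using Submodule.span_induction with
    | zero => simp
    | add x y _ _ hx hy =>
      simp only [map_add, hx, hy]
      abel
    | smul a x _ hx =>
      simp only [map_add, LinearMap.map_smulₛₗ, nabla.leibniz, smul_eq_mul, Derivation.leibniz,
        hx, hδ]
      ring
    | mem x hx =>
      obtain ⟨j, rfl⟩ := hx
      have hQ' := congrFun (congrFun hQ i) j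
      simp only [Matrix.mul_apply, transpose_apply] at hQ'
      have hQ'' := congrArg (C : R →+* R[T;T⁻¹]) hQ'
      simp only [map_sum, map_mul] at hQ''
      rw [sesqForm_basis, hP, hcov, hcov]
      simp only [map_sum, LinearMap.sum_apply, map_smul, LinearMap.smul_apply, LinearMap.map_smulₛₗ,
        sesqForm_basis, map_add, map_mul, negTheta_C, negTheta_T_neg_one, Matrix.add_apply,
        Matrix.mul_apply, transpose_apply, smul_eq_mul, add_mul, Finset.sum_add_distrib,
        Finset.sum_mul]
      have e₁ : ∑ x, T (-1) * C (Q x i) * (C (g x j) * T d) =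
          T (-1) * T d * ∑ x, (C (Q x i) * C (g x j) : R[T;T⁻¹]) := by
        rw [Finset.mul_sum]
        exact Finset.sum_congr rfl fun _ _ => by ring
      have e₂ : ∑ x, -T (-1) * C (Q x j) * (C (g i x) * T d) =
          -(T (-1) * T d * ∑ x, (C (g i x) * C (Q x j) : R[T;T⁻¹])) := by
        rw [Finset.mul_sum, ← Finset.sum_neg_distrib]
        exact Finset.sum_congr rfl fun _ _ => by ring
      rw [e₁, e₂, hQ'']
      have e₃ : ∑ x, C (P x j) * (C (g i x) * T d) =
          ∑ x, (C (g i x) * C (P x j) * T d : R[T;T⁻¹]) :=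
        Finset.sum_congr rfl fun _ _ => by ring
      rw [e₃]
      simp only [mul_assoc]
      abel

/-- A flat connection which has in a basis the form `d + P + θ⁻¹ Q`, with `P` and `Q` independent of
`θ`, and which is compatible with a non-degenerate constant Gram matrix, is a quantum differential
system. -/
theorem isQuantumDifferentialSystem_of_matrix [Algebra ℂ R] {nabla : Connection ℂ R[T;T⁻¹] G}
    (hflat : nabla.IsFlat) (hg : IsUnit g.det) {Pθ Qθ : Matrix (Fin r) (Fin r) R}
    {P Q : Derivation ℂ R R → Matrix (Fin r) (Fin r) R}
    (hθ : ∀ j, nabla.cov (thetaDer R ℂ) (b j) = ∑ i, (C (Pθ i j) + T (-1) * C (Qθ i j)) • b i)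
    (hX : ∀ X j, nabla.cov (liftDer X) (b j) = ∑ i, (C (P X i j) + T (-1) * C (Q X i j)) • b i)
    (hPθ : Pθᵀ * g + g * Pθ = d • g) (hQθ : Qθᵀ * g = g * Qθ)
    (hP : ∀ X i j, ((P X)ᵀ * g + g * P X) i j = X (g i j)) (hQ : ∀ X, (Q X)ᵀ * g = g * Q X) :
    IsQuantumDifferentialSystem (Submodule.span (chartZero R) (Set.range b))
      (Submodule.span (chartInf R) (Set.range b)) nabla (sesqForm b g d) d := by
  -- Multiplying by `θ` turns `P + θ⁻¹Q` into `θP + Q`, which lies over `R[θ]`; without this factor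
  -- it lies over `R[τ]`.
  have pole : ∀ P Q : Matrix (Fin r) (Fin r) R, ∀ j,
      (T 1 : R[T;T⁻¹]) • ∑ i, (C (P i j) + T (-1) * C (Q i j) : R[T;T⁻¹]) • b i ∈
        Submodule.span (chartZero R) (Set.range b) := fun P Q j => by
    rw [Finset.smul_sum]
    refine sum_mem fun i _ => ?_
    have hT : (T 1 : R[T;T⁻¹]) * T (-1) = 1 := by rw [← T_add, add_neg_cancel, T_zero]
    have hA : T 1 * C (P i j) + C (Q i j) ∈ chartZero R :=
      add_mem (mul_mem (Algebra.subset_adjoin rfl) (Subalgebra.algebraMap_mem _ _))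
        (Subalgebra.algebraMap_mem _ _)
    rw [smul_smul, mul_add, ← mul_assoc _ (T (-1)), hT, one_mul]
    exact Submodule.smul_mem _ (⟨_, hA⟩ : chartZero R) (Submodule.subset_span ⟨i, rfl⟩)
  have log : ∀ P Q : Matrix (Fin r) (Fin r) R, ∀ j,
      (1 : R[T;T⁻¹]) • ∑ i, (C (P i j) + T (-1) * C (Q i j) : R[T;T⁻¹]) • b i ∈
        Submodule.span (chartInf R) (Set.range b) := fun P Q j => by
    rw [one_smul]
    refine sum_mem fun i _ => ?_
    have hA : C (P i j) + T (-1) * C (Q i j) ∈ chartInf R :=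
      add_mem (Subalgebra.algebraMap_mem _ _)
        (mul_mem (Algebra.subset_adjoin rfl) (Subalgebra.algebraMap_mem _ _))
    exact Submodule.smul_mem _ (⟨_, hA⟩ : chartInf R) (Submodule.subset_span ⟨i, rfl⟩)
  refine ⟨⟨r, b, rfl, rfl⟩, hflat, ?_, fun X => ?_, ?_, fun X => ?_, ?_, fun X => ?_, ?_, ?_⟩
  · exact smul_cov_mem_span _ _ (fun _ => thetaDer_mem_adjoin 1) (Algebra.subset_adjoin rfl)
      fun i => by rw [hθ]; exact pole _ _ i
  · exact smul_cov_mem_span _ _ (fun _ => liftDer_mem_adjoin X 1) (Algebra.subset_adjoin rfl)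
      fun i => by rw [hX]; exact pole _ _ i
  · have := smul_cov_mem_span (b := b) (nabla := nabla) _ _
      (fun _ => thetaDer_mem_adjoin (R := R) (k := ℂ) (-1)) (one_mem _)
      fun i => by rw [hθ]; exact log _ _ i
    simpa only [one_smul] using this
  · have := smul_cov_mem_span (b := b) (nabla := nabla) _ _
      (fun _ => liftDer_mem_adjoin X (-1)) (one_mem _)
      fun i => by rw [hX]; exact log _ _ i
    simpa only [one_smul] using this
  · refine sesqForm_flat _ thetaDer_negTheta hθ (fun i j => ?_) hQθ
    rw [hPθ, Derivation.leibniz, thetaDer_C, thetaDer_T, Matrix.smul_apply, map_zsmul]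
    simp only [smul_eq_mul, zsmul_eq_mul, map_intCast]
    ring
  · refine sesqForm_flat _ (liftDer_negTheta X) (hX X) (fun i j => ?_) (hQ X)
    rw [hP, Derivation.leibniz, liftDer_C, liftDer_T]
    simp only [smul_eq_mul]
    ring
  · exact isPerfectOn_sesqForm hg _ fun _ => negTheta_mem_adjoin 1
  · exact isPerfectOn_sesqForm hg _ fun _ => negTheta_mem_adjoin (-1)

end Criterion
end QDS

namespace QDS

/-! ### Reduction of the products needed for the connection -/

namespace IsSolution

variable {A W : Type*} [CommRing A] [AddCommGroup W] [Module A W] {θ q₁ q₂ : A} {π : ℤ × ℤ → W}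

/-- This is the class of `ω₂` times `q₁u₂²/u₁ = q₁∂F/∂q₁`. Likewise `eval_neg_one_zero` treats `ω₂`
times `q₂/u₂`, and `eval_neg_two_four` treats `ω₃` times `q₁u₂²/u₁`. -/
theorem eval_neg_two_three (h : IsSolution θ q₁ q₂ π) :
    (q₁ ^ 2 * q₂) • π (-2, 3) = (q₁ * q₂) • omegaOf q₁ q₂ π 1
      - (2 * q₁ * q₂) • omegaOf q₁ q₂ π 3 + θ • omegaOf q₁ q₂ π 2 := by
  have e := h.rel₁ (-1) 1
  have e' := h.eval_zero_one
  have j : (1 : ℤ) + 2 = 3 := rfl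
  have j' : (-1 : ℤ) - 1 = -2 := rfl
  simp only [neg_add_cancel, j, j'] at e
  push_cast at e
  simp only [omegaOf, Matrix.cons_val] at e' ⊢
  linear_combination (norm := module) -(q₁ * q₂) • e + (q₁ * q₂) • e'

theorem eval_neg_one_zero (h : IsSolution θ q₁ q₂ π) :
    (q₁ * q₂ ^ 2) • π (-1, 0) = θ • omegaOf q₁ q₂ π 2 + (2 * q₁ * q₂) • omegaOf q₁ q₂ π 1
      - (q₂ * (4 * q₁ - 1)) • omegaOf q₁ q₂ π 3 := by
  have e := h.column_succ (-1) 1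
  have e' := h.eval_zero_one
  have j : (1 : ℤ) + 1 = 2 := rfl
  simp only [neg_add_cancel, sub_self, j] at e
  push_cast at e
  simp only [omegaOf, Matrix.cons_val] at e' ⊢
  linear_combination (norm := module) -(q₁ * q₂) • e + (2 * q₁ * q₂) • e'

theorem eval_neg_two_four (h : IsSolution θ q₁ q₂ π) {v : A} (hv : v * (4 * q₁ - 1) = 1) :
    q₁ ^ 2 • π (-2, 4) = (2 * q₁ * v) • omegaOf q₁ q₂ π 2 - (q₁ * v * q₂) • omegaOf q₁ q₂ π 0
      - (θ * q₁ * v) • omegaOf q₁ q₂ π 1 + (θ + 2 * θ * q₁ * v) • omegaOf q₁ q₂ π 3 := by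
  have e₁ := h.rel₁ (-1) 2
  have e₂ := h.column_succ (-1) 2
  have e₃ := h.rel₂ 0 1
  have e' := h.eval_zero_one
  have j₁ : (2 : ℤ) + 2 = 4 := rfl
  have j₂ : (-1 : ℤ) - 1 = -2 := rfl
  have j₃ : (2 : ℤ) - 1 = 1 := rfl
  have j₄ : (2 : ℤ) + 1 = 3 := rfl
  have j₅ : (1 : ℤ) + 2 = 3 := rfl
  have j₆ : (1 : ℤ) + 1 = 2 := rfl
  simp only [neg_add_cancel, sub_self, zero_sub, j₁, j₂, j₃, j₄, j₅, j₆] at e₁ e₂ e₃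
  push_cast at e₁ e₂ e₃
  -- Eliminating `π (-1, 3)` between `e₂` and `e₃` gives `(4q₁ - 1) π (0, 2)`; this is where `v`
  -- enters.
  have e₄ : (v * (4 * q₁ - 1)) • π (0, 2) = π (0, 2) := by rw [hv, one_smul]
  simp only [omegaOf, Matrix.cons_val] at e' ⊢
  linear_combination (norm := module) -q₁ • e₁ + (2 * q₁ ^ 2 * v) • e₂ - (q₁ * v) • e₃ - q₁ • e₄
    - (q₁ * v * θ) • e'

end IsSolution

open LaurentPolynomial

/-! ### The Gauss–Manin connection on monomials -/

section Connection

variable {R : Type*} [CommRing R] (q₁ q₂ : R)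

theorem isSolution_gaussManin : IsSolution (T 1 : R[T;T⁻¹]) (C q₁) (C q₂)
    fun m => GaussManin.mk (F q₁ q₂) (.single m 1) :=
  (range_twistedD_le_ker_iff _ _ _ _).1 (ker_gaussManinMk q₁ q₂).ge

theorem omegaGM_eq_omegaOf : omegaGM q₁ q₂ =
    omegaOf (C q₁ : R[T;T⁻¹]) (C q₂) fun m => GaussManin.mk (F q₁ q₂) (.single m 1) :=
  funext fun i => (omegaGM_eq_mk q₁ q₂ i).trans (map_omegaFun _ _ _ i)

variable {k : Type*} [CommRing k] [Algebra k R]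

theorem cov_mk_single (δ : Derivation k R[T;T⁻¹] R[T;T⁻¹]) (a b : ℤ) :
    (gaussManinConnection k (F q₁ q₂)).cov δ (GaussManin.mk _ (.single (a, b) 1)) =
      -(δ (T (-1)) • GaussManin.mk (F q₁ q₂) (.single (a + 1, b) 1)
        + δ (T (-1)) • GaussManin.mk (F q₁ q₂) (.single (a, b + 1) 1)
        + δ (T (-1) * C q₁) • GaussManin.mk (F q₁ q₂) (.single (a - 1, b + 2) 1)
        + δ (T (-1) * C q₂) • GaussManin.mk (F q₁ q₂) (.single (a, b - 1) 1)) := by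
  have hC : ∀ r : R, algebraMap R R[T;T⁻¹] r = C r := fun _ => rfl
  rw [gaussManinConnection_mk]
  simp only [← map_smul, ← map_add, ← map_neg]
  congr 1
  rw [phaseCov_apply, coeffDer_single, δ.map_one_eq_zero, AddMonoidAlgebra.single_zero, zero_sub,
    phase, baseChange_F, F]
  simp only [smul_add, AddMonoidAlgebra.smul_single, map_add, coeffDer_single, add_mul,
    AddMonoidAlgebra.single_mul_single, Prod.mk_add_mk, smul_eq_mul, mul_one, zero_add, hC]
  simp only [neg_add_eq_sub, add_comm (1 : ℤ), add_comm (2 : ℤ)]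

theorem cov_liftDer_mk_single (X : Derivation k R R) (a b : ℤ) :
    (gaussManinConnection k (F q₁ q₂)).cov (liftDer X) (GaussManin.mk _ (.single (a, b) 1)) =
      -((T (-1) * C (X q₁)) • GaussManin.mk (F q₁ q₂) (.single (a - 1, b + 2) 1)
        + (T (-1) * C (X q₂)) • GaussManin.mk (F q₁ q₂) (.single (a, b - 1) 1)) := by
  rw [cov_mk_single, Derivation.leibniz, Derivation.leibniz, liftDer_T, liftDer_C, liftDer_C]
  simp

/-- Euler's identity: `F = (D₁ + D₂)F + 2q₂/u₂`. In the quotient `(D₁ + D₂)F` acts on `u₁ᵃu₂ᵇ` as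
`θ(a + b)`. -/
theorem cov_thetaDer_mk_single (a b : ℤ) :
    (gaussManinConnection k (F q₁ q₂)).cov (thetaDer R k) (GaussManin.mk _ (.single (a, b) 1)) =
      (a + b : R[T;T⁻¹]) • GaussManin.mk (F q₁ q₂) (.single (a, b) 1)
        + (2 * T (-1) * C q₂) • GaussManin.mk (F q₁ q₂) (.single (a, b - 1) 1) := by
  have e₁ := (isSolution_gaussManin q₁ q₂).rel₁ a b
  have e₂ := (isSolution_gaussManin q₁ q₂).rel₂ a b
  have e₃ : (T (-1) * T 1 : R[T;T⁻¹]) • GaussManin.mk (F q₁ q₂) (.single (a, b) 1) =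
      GaussManin.mk (F q₁ q₂) (.single (a, b) 1) := by
    rw [← T_add, neg_add_cancel, T_zero, one_smul]
  rw [cov_mk_single, Derivation.leibniz, Derivation.leibniz, thetaDer_T, thetaDer_C, thetaDer_C]
  simp only [smul_eq_mul, mul_zero, zero_add, Int.cast_neg, Int.cast_one,
    map_neg, map_one] at e₁ e₂ ⊢
  linear_combination (norm := module)
    (T (-1) : R[T;T⁻¹]) • e₁ + (T (-1) : R[T;T⁻¹]) • e₂ + (a + b : R[T;T⁻¹]) • e₃

end Connection

/-! ### Connection matrices in the frame `ω` -/

section Matrices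

variable {R : Type*} [CommRing R] (q₁ q₂ v x₁ x₂ : R)

/-- The residual part of the matrix of `∇_X`, where `X q₁ = x₁ q₁`. -/
def baseP : Matrix (Fin 4) (Fin 4) R :=
  !![0, 0, 0, 0;
     0, 0, 0, x₁ * q₁ * v;
     0, 0, 0, 0;
     0, 0, 0, -(2 * x₁ * q₁ * v)]

/-- The polar part of the matrix of `∇_X`, where `X qᵢ = xᵢ qᵢ`. -/
def baseQ : Matrix (Fin 4) (Fin 4) R :=
  !![0, -(x₂ * q₂), 0, x₁ * q₁ * v * q₂;
     -x₂, 0, -(x₁ * q₁ * q₂ + 2 * x₂ * q₁ * q₂), 0;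
     0, -(x₁ + 2 * x₂), 0, -(2 * x₁ * q₁ * v + x₂);
     -x₁, 0, 2 * x₁ * q₁ * q₂ + x₂ * q₂ * (4 * q₁ - 1), 0]

/-- The residual part of the matrix of `∇_{θ∂_θ}`. -/
def thetaP : Matrix (Fin 4) (Fin 4) R :=
  !![0, 0, 0, 0;
     0, 1, 0, 0;
     0, 0, 2, 0;
     0, 0, 0, 1]

/-- The polar part of the matrix of `∇_{θ∂_θ}`. -/
def thetaQ : Matrix (Fin 4) (Fin 4) R :=
  !![0, 2 * q₂, 0, 0;
     2, 0, 4 * q₁ * q₂, 0;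
     0, 4, 0, 2;
     0, 0, -(2 * q₂ * (4 * q₁ - 1)), 0]

variable {q₁ q₂ v x₁ x₂} {k : Type*} [CommRing k] [Algebra k R]

/-- The residual part collects the derivatives of the coefficients and the terms of degree one in
`θ` of the reduced products. They cancel except on `ω₃`. -/
theorem cov_liftDer_omegaGM (hv : v * (4 * q₁ - 1) = 1) (X : Derivation k R R)
    (h₁ : X q₁ = x₁ * q₁) (h₂ : X q₂ = x₂ * q₂) (j : Fin 4) :
    (gaussManinConnection k (F q₁ q₂)).cov (liftDer X) (omegaGM q₁ q₂ j) =
      ∑ i, (C (baseP q₁ v x₁ i j) + T (-1) * C (baseQ q₁ q₂ v x₁ x₂ i j)) • omegaGM q₁ q₂ i := by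
  have hs := isSolution_gaussManin q₁ q₂
  have hv' : (C v * (4 * C q₁ - 1) : R[T;T⁻¹]) = 1 := by
    have := congrArg (C : R →+* R[T;T⁻¹]) hv
    simpa only [map_mul, map_sub, map_ofNat, map_one] using this
  have hT : ∀ w : GaussManin (F q₁ q₂), (T (-1) * T 1 : R[T;T⁻¹]) • w = w := fun w => by
    rw [← T_add, neg_add_cancel, T_zero, one_smul]
  have e₁ := hs.eval_zero_neg_two
  have e₂ := hs.eval_neg_two_three
  have e₃ := hs.eval_neg_one_zero
  have e₄ := hs.eval_neg_two_four hv'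
  rw [Fin.sum_univ_four]
  fin_cases j <;>
    simp only [omegaGM_eq_omegaOf, baseP, baseQ, omegaOf, Fin.mk_zero, Fin.mk_one,
      Fin.reduceFinMk, Matrix.cons_val, Matrix.of_apply, Connection.leibniz, cov_liftDer_mk_single,
      liftDer_C, map_mul, Derivation.leibniz, h₁, h₂, map_zero, map_neg, map_add, map_sub, map_ofNat,
      map_one, Fin.isValue, smul_eq_mul, Int.reduceNeg, Int.reduceAdd, Int.reduceSub] at e₁ e₂ e₃ e₄ ⊢
  · module
  · linear_combination (norm := module) -(T (-1) * C x₂ : R[T;T⁻¹]) • e₁ -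
      (C x₂ * C q₂) • hT (GaussManin.mk (F q₁ q₂) (.single (0, -1) 1))
  · linear_combination (norm := module) -(T (-1) * C x₁ : R[T;T⁻¹]) • e₂ - (T (-1) * C x₂ : R[T;T⁻¹]) • e₃ -
      ((C x₁ + C x₂) * C q₁ * C q₂) • hT (GaussManin.mk (F q₁ q₂) (.single (-1, 1) 1))
  · linear_combination (norm := module) -(T (-1) * C x₁ : R[T;T⁻¹]) • e₄
      + (C x₁ * C q₁ * C v * C q₂) • hT (GaussManin.mk (F q₁ q₂) (.single (0, -1) 1)) -
      (C x₁ * (1 + 2 * C q₁ * C v) * C q₁) • hT (GaussManin.mk (F q₁ q₂) (.single (-1, 2) 1))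

/-- The weights `a + b` of the monomials are `0, -1, 0, 1`; the terms linear in `θ` of the reduced
products add `2` to the second and third, giving the exponents `0, 1, 2, 1`. -/
theorem cov_thetaDer_omegaGM (j : Fin 4) :
    (gaussManinConnection k (F q₁ q₂)).cov (thetaDer R k) (omegaGM q₁ q₂ j) =
      ∑ i, (C (thetaP i j) + T (-1) * C (thetaQ q₁ q₂ i j)) • omegaGM q₁ q₂ i := by
  have hs := isSolution_gaussManin q₁ q₂
  have hT : ∀ w : GaussManin (F q₁ q₂), (T (-1) * T 1 : R[T;T⁻¹]) • w = w := fun w => by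
    rw [← T_add, neg_add_cancel, T_zero, one_smul]
  have e₁ := hs.eval_zero_neg_two
  have e₃ := hs.eval_neg_one_zero
  rw [Fin.sum_univ_four]
  fin_cases j <;>
    simp only [omegaGM_eq_omegaOf, thetaP, thetaQ, omegaOf, Fin.mk_zero, Fin.mk_one,
      Fin.reduceFinMk, Matrix.cons_val, Matrix.of_apply, Connection.leibniz, cov_thetaDer_mk_single,
      ← map_mul, thetaDer_C, map_zero, Fin.isValue, Int.reduceNeg, Int.reduceSub] at e₁ e₃ ⊢ <;>
    simp only [map_mul, map_neg, map_sub, map_ofNat, map_one, Int.cast_zero,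
      Int.cast_one, Int.cast_neg, Int.cast_ofNat] at e₁ e₃ ⊢
  · module
  · linear_combination (norm := module) (2 * T (-1) : R[T;T⁻¹]) • e₁ +
      (2 * C q₂) • hT (GaussManin.mk (F q₁ q₂) (.single (0, -1) 1))
  · linear_combination (norm := module) (2 * T (-1) : R[T;T⁻¹]) • e₃ +
      (2 * C q₁ * C q₂) • hT (GaussManin.mk (F q₁ q₂) (.single (-1, 1) 1))
  · module

end Matrices
end QDS

namespace QDS

/-! ### Flatness of the Gauss–Manin connection -/

section Flat

theorem coeffDer_lie {k K M : Type*} [CommRing k] [CommRing K] [Algebra k K] [AddCommMonoid M]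
    (D E : Derivation k K K) (x : AddMonoidAlgebra K M) :
    coeffDer ⁅D, E⁆ x = coeffDer D (coeffDer E x) - coeffDer E (coeffDer D x) := by
  induction x using AddMonoidAlgebra.induction_linear with
  | zero => simp
  | add f g hf hg => simp only [map_add, hf, hg]; abel
  | single a r => simp [Derivation.commutator_apply]

/-- `δ ↦ coeffDer δ` respects brackets, and conjugation by `e^{-F/θ}` does not change commutators.
The identity already holds on forms. -/
theorem gaussManinConnection_isFlat {k R : Type*} [CommRing R] [CommRing k] [Algebra k R]
    (F : TorusFun R) : (gaussManinConnection k F).IsFlat := by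
  intro δ ε m
  obtain ⟨g, rfl⟩ := GaussManin.mk_surjective F m
  simp only [gaussManinConnection_mk, ← map_sub]
  congr 1
  simp only [phaseCov_apply, coeffDer_lie, map_sub, Derivation.leibniz, smul_eq_mul]
  ring

end Flat

/-! ### The Gram matrix and assembly of the system -/

section Hirzebruch

variable {R : Type*} [CommRing R] {q₁ q₂ v x₁ x₂ : R}

theorem gram_eq (hv : v * (4 * q₁ - 1) = 1) : gram q₁ =
    !![0, 0, 1, 0;
       0, 2, 0, 1;
       1, 0, 0, 0;
       0, 1, 0, 2 * q₁ * v] := by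
  have : Ring.inverse (4 * q₁ - 1) = v := by
    have h := Ring.inverse_mul_cancel _ (IsUnit.of_mul_eq_one_right _ hv)
    linear_combination v * h - Ring.inverse (4 * q₁ - 1) * hv
  rw [gram, this]

theorem gram_det (hv : v * (4 * q₁ - 1) = 1) : (gram q₁).det = -v := by
  rw [gram_eq hv]
  simp [Matrix.det_succ_row_zero, Fin.sum_univ_succ, Fin.succAbove]
  linear_combination -hv

theorem thetaP_gram (hv : v * (4 * q₁ - 1) = 1) :
    thetaP.transpose * gram q₁ + gram q₁ * thetaP = (2 : ℤ) • gram q₁ := by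
  rw [gram_eq hv]
  ext i j
  fin_cases i <;> fin_cases j <;>
    simp [thetaP, Matrix.mul_apply, Fin.sum_univ_four] <;> ring

theorem thetaQ_gram (hv : v * (4 * q₁ - 1) = 1) :
    (thetaQ q₁ q₂).transpose * gram q₁ = gram q₁ * thetaQ q₁ q₂ := by
  rw [gram_eq hv]
  ext i j
  fin_cases i <;> fin_cases j <;>
    simp [thetaQ, Matrix.mul_apply, Fin.sum_univ_four] <;> grind

theorem baseP_gram {k : Type*} [CommRing k] [Algebra k R] (hv : v * (4 * q₁ - 1) = 1)
    (X : Derivation k R R) (h₁ : X q₁ = x₁ * q₁) (i j : Fin 4) :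
    ((baseP q₁ v x₁).transpose * gram q₁ + gram q₁ * baseP q₁ v x₁) i j = X (gram q₁ i j) := by
  have h2 : X 2 = 0 := X.map_natCast 2
  have h4 : X 4 = 0 := X.map_natCast 4
  -- Differentiate `v(4q₁ - 1) = 1` and multiply by `v`.
  have hXv : X v = -(4 * x₁ * q₁ * v ^ 2) := by
    have := congrArg X hv
    simp only [Derivation.leibniz, map_sub, h4, h₁, X.map_one_eq_zero, smul_eq_mul] at this
    linear_combination v * this - X v * hv
  rw [gram_eq hv]
  fin_cases i <;> fin_cases j <;>
    simp [baseP, Matrix.mul_apply, Fin.sum_univ_four, h2, h₁, hXv] <;> ring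

theorem baseQ_gram (hv : v * (4 * q₁ - 1) = 1) :
    (baseQ q₁ q₂ v x₁ x₂).transpose * gram q₁ = gram q₁ * baseQ q₁ q₂ v x₁ x₂ := by
  rw [gram_eq hv]
  ext i j
  fin_cases i <;> fin_cases j <;>
    simp [baseQ, Matrix.mul_apply, Fin.sum_univ_four] <;> grind

theorem omegaGM_eq_cov {k : Type*} [CommRing k] [Algebra k R] (X₁ X₂ : Derivation k R R)
    (h₁₁ : X₁ q₁ = 1) (h₁₂ : X₁ q₂ = 0) (h₂₁ : X₂ q₁ = 0) (h₂₂ : X₂ q₂ = 1) :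
    let θ : R[T;T⁻¹] := LaurentPolynomial.T 1
    let nabla := (gaussManinConnection k (F q₁ q₂)).cov
    let nabla₁ := nabla (liftDer (q₁ • X₁))
    let nabla₂ := nabla (liftDer (q₂ • X₂))
    let ω := omegaGM q₁ q₂
    ω 1 = -(θ • nabla₂ (ω 0)) ∧ ω 2 = θ • nabla₂ (θ • nabla₁ (ω 0)) ∧
      ω 3 = -(θ • nabla₁ (ω 0)) := by
  intro θ nabla nabla₁ nabla₂ ω
  have hT : θ * LaurentPolynomial.T (-1) = 1 := by
    rw [← LaurentPolynomial.T_add, add_neg_cancel, LaurentPolynomial.T_zero]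
  have e₃ : ω 3 = -(θ • nabla₁ (ω 0)) := by
    simp only [ω, nabla₁, nabla, omegaGM_eq_omegaOf, omegaOf, Matrix.cons_val,
      cov_liftDer_mk_single, Derivation.smul_apply, h₁₁, h₁₂, smul_eq_mul, mul_one, mul_zero,
      map_zero, zero_smul, add_zero, smul_neg, neg_neg, smul_smul, ← mul_assoc, hT, one_mul]
    rfl
  refine ⟨?_, ?_, e₃⟩
  · simp only [ω, nabla₂, nabla, omegaGM_eq_omegaOf, omegaOf, Matrix.cons_val,
      cov_liftDer_mk_single, Derivation.smul_apply, h₂₁, h₂₂, smul_eq_mul, mul_one, mul_zero,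
      map_zero, zero_smul, zero_add, smul_neg, neg_neg, smul_smul, ← mul_assoc, hT, one_mul]
    rfl
  -- `θ∇₁ω₀ = -ω₃`, whose coefficient `q₁` is killed by `X₂`, so `∇₂` only multiplies by
  -- `-θ⁻¹q₂/u₂`.
  · rw [← neg_eq_iff_eq_neg.2 e₃, map_neg]
    simp only [ω, nabla₂, nabla, omegaGM_eq_omegaOf, omegaOf, Matrix.cons_val, Connection.leibniz,
      cov_liftDer_mk_single, Derivation.smul_apply, h₂₁, h₂₂, smul_eq_mul, mul_one, mul_zero,
      liftDer_C, map_zero, zero_smul, zero_add, smul_neg, neg_neg, smul_smul, ← mul_assoc]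
    rw [mul_right_comm θ, hT, one_mul]
    rfl

theorem exists_isQuantumDifferentialSystem [Algebra ℂ R] (h₁ : IsUnit q₁) (h₂ : IsUnit q₂)
    (h₄ : IsUnit (4 * q₁ - 1)) :
    ∃ S : GaussManin (F q₁ q₂) →ₗ[R[T;T⁻¹]] GaussManin (F q₁ q₂) →ₛₗ[negTheta R] R[T;T⁻¹],
      (∀ i j, S (omegaGM q₁ q₂ i) (omegaGM q₁ q₂ j) =
        LaurentPolynomial.C (gram q₁ i j) * LaurentPolynomial.T 2) ∧
      IsQuantumDifferentialSystem (brieskornLattice (F q₁ q₂))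
        (Submodule.span (chartInf R) (Set.range (omegaGM q₁ q₂)))
        (gaussManinConnection ℂ (F q₁ q₂)) S 2 := by
  have h2 : IsUnit (2 : R) := isUnit_two_of_algebra (R := ℂ) (IsUnit.mk0 2 two_ne_zero)
  obtain ⟨b, hb⟩ := exists_basis_omegaGM h2 h₁ h₂ h₄
  obtain ⟨v, hv⟩ := h₄.exists_left_inv
  obtain ⟨p₁, hp₁⟩ := h₁.exists_left_inv
  obtain ⟨p₂, hp₂⟩ := h₂.exists_left_inv
  have hb' : omegaGM q₁ q₂ = b := funext fun i => (hb i).symm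
  have hdet : IsUnit (gram q₁).det := by
    rw [gram_det hv]
    exact (IsUnit.of_mul_eq_one _ hv).neg
  rw [brieskornLattice_eq_span h2 h₁ h₂ h₄]
  refine ⟨sesqForm b (gram q₁) 2, fun i j => ?_, ?_⟩
  · rw [hb']
    exact sesqForm_basis b _ 2 i j
  · rw [hb']
    -- Since `qᵢ` is a unit with inverse `pᵢ`, every `X` takes the logarithmic form `X qᵢ = xᵢqᵢ`
    -- with `xᵢ = (X qᵢ)pᵢ`.
    refine isQuantumDifferentialSystem_of_matrix (Pθ := thetaP) (Qθ := thetaQ q₁ q₂)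
      (P := fun X => baseP q₁ v (X q₁ * p₁))
      (Q := fun X => baseQ q₁ q₂ v (X q₁ * p₁) (X q₂ * p₂))
      (gaussManinConnection_isFlat _) hdet (fun j => ?_) (fun X j => ?_) (thetaP_gram hv)
      (thetaQ_gram hv) (fun X => baseP_gram hv X ?_) (fun X => baseQ_gram hv)
    · rw [← hb']
      exact cov_thetaDer_omegaGM j
    · rw [← hb']
      exact cov_liftDer_omegaGM hv X (by rw [mul_assoc, hp₁, mul_one])
        (by rw [mul_assoc, hp₂, mul_one]) j
    · rw [mul_assoc, hp₁, mul_one]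

end Hirzebruch

/-! ### Units in the rings of regular and holomorphic functions -/

section Functions

theorem isUnit_of_inv_mem {𝒪 : Subalgebra ℂ (M → ℂ)} (f : 𝒪) (h : ∀ q, (f : M → ℂ) q ≠ 0)
    (hi : (fun q => ((f : M → ℂ) q)⁻¹) ∈ 𝒪) : IsUnit f :=
  IsUnit.of_mul_eq_one ⟨_, hi⟩ <| Subtype.ext <| funext fun q => mul_inv_cancel₀ (h q)

theorem inv_mem_holomorphicFunctions {f : ℂ × ℂ → ℂ} (hf : DifferentiableOn ℂ f M)
    (h : ∀ q ∈ M, f q ≠ 0) : (fun q : M => (f q)⁻¹) ∈ holomorphicFunctions :=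
  ⟨fun q => (f q)⁻¹, hf.inv h, fun _ => rfl⟩

theorem four_mul_sub_one_ne_zero (q : M) : 4 * q.1.1 - 1 ≠ 0 := fun h =>
  q.2.2 (by linear_combination h / 4)

/-- The only input from the choice of `𝒪`: the three functions have no zero on `M`, and their
inverses are generators in the regular case and holomorphic in the other. -/
theorem isUnit_coordinates {𝒪 : Subalgebra ℂ (M → ℂ)}
    (h𝒪 : 𝒪 = regularFunctions ∨ 𝒪 = holomorphicFunctions) (q₁ q₂ : 𝒪)
    (hq₁ : ∀ q : M, (q₁ : M → ℂ) q = q.1.1) (hq₂ : ∀ q : M, (q₂ : M → ℂ) q = q.1.2) :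
    IsUnit q₁ ∧ IsUnit q₂ ∧ IsUnit (4 * q₁ - 1) := by
  have h₄ : ∀ q : M, ((4 * q₁ - 1 : 𝒪) : M → ℂ) q = 4 * q.1.1 - 1 := fun q => by
    rw [← hq₁]
    rfl
  refine ⟨isUnit_of_inv_mem _ (fun q => ?_) ?_, isUnit_of_inv_mem _ (fun q => ?_) ?_,
    isUnit_of_inv_mem _ (fun q => ?_) ?_⟩
  · rw [hq₁]
    exact left_ne_zero_of_mul q.2.1
  · simp only [hq₁]
    rcases h𝒪 with rfl | rfl
    · exact Algebra.subset_adjoin (by simp)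
    · exact inv_mem_holomorphicFunctions (f := fun q => q.1) (by fun_prop)
        fun q hq => left_ne_zero_of_mul hq.1
  · rw [hq₂]
    exact right_ne_zero_of_mul q.2.1
  · simp only [hq₂]
    rcases h𝒪 with rfl | rfl
    · exact Algebra.subset_adjoin (by simp)
    · exact inv_mem_holomorphicFunctions (f := fun q => q.2) (by fun_prop)
        fun q hq => right_ne_zero_of_mul hq.1
  · rw [h₄]
    exact four_mul_sub_one_ne_zero q
  · simp only [h₄]
    rcases h𝒪 with rfl | rfl
    · exact Algebra.subset_adjoin (by simp)
    · exact inv_mem_holomorphicFunctions (f := fun q => 4 * q.1 - 1) (by fun_prop)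
        fun q hq => four_mul_sub_one_ne_zero ⟨q, hq⟩

end Functions
end QDS

theorem mainTheorem6
    -- `𝒪` is the ring of regular, or of holomorphic, functions on `M`, with coordinates `q₁, q₂`
    (𝒪 : Subalgebra ℂ (QDS.M → ℂ))
    (h𝒪 : 𝒪 = QDS.regularFunctions ∨ 𝒪 = QDS.holomorphicFunctions)
    (q₁ q₂ : 𝒪)
    (hq₁ : ∀ q : QDS.M, (q₁ : QDS.M → ℂ) q = q.1.1)
    (hq₂ : ∀ q : QDS.M, (q₂ : QDS.M → ℂ) q = q.1.2) :
    -- the Brieskorn module is free over `𝒪[θ]` with basis `ω` and embeds in the Gauss–Manin system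
    (∃ b : Module.Basis (Fin 4) (QDS.chartZero 𝒪) (QDS.BrieskornModule (QDS.F q₁ q₂)),
      ∀ i, b i = QDS.omega q₁ q₂ i) ∧
    Function.Injective (QDS.toGaussManin (QDS.F q₁ q₂)) ∧
    -- `ω` in terms of the covariant derivatives of `ω₀`
    (∀ X₁ X₂ : Derivation ℂ 𝒪 𝒪,
      X₁ q₁ = 1 → X₁ q₂ = 0 → X₂ q₁ = 0 → X₂ q₂ = 1 →
      let θ : LaurentPolynomial 𝒪 := LaurentPolynomial.T 1
      let nabla := (QDS.gaussManinConnection ℂ (QDS.F q₁ q₂)).cov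
      let nabla₁ := nabla (QDS.liftDer (q₁ • X₁))
      let nabla₂ := nabla (QDS.liftDer (q₂ • X₂))
      let ω := QDS.omegaGM q₁ q₂
      ω 1 = -(θ • nabla₂ (ω 0)) ∧
      ω 2 = θ • nabla₂ (θ • nabla₁ (ω 0)) ∧
      ω 3 = -(θ • nabla₁ (ω 0))) ∧
    -- the Brieskorn lattice, its extension at `θ = ∞` generated by `ω`, the Gauss–Manin connection
    -- and the form `S` are a quantum differential system with `d = 2`
    ∃ S : QDS.GaussManin (QDS.F q₁ q₂) →ₗ[LaurentPolynomial 𝒪]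
        QDS.GaussManin (QDS.F q₁ q₂) →ₛₗ[QDS.negTheta 𝒪] LaurentPolynomial 𝒪,
      (∀ i j, S (QDS.omegaGM q₁ q₂ i) (QDS.omegaGM q₁ q₂ j) =
        LaurentPolynomial.C (QDS.gram q₁ i j) * LaurentPolynomial.T 2) ∧
      QDS.IsQuantumDifferentialSystem
        (QDS.brieskornLattice (QDS.F q₁ q₂))
        (Submodule.span (QDS.chartInf 𝒪) (Set.range (QDS.omegaGM q₁ q₂)))
        (QDS.gaussManinConnection ℂ (QDS.F q₁ q₂)) S 2 := by
  obtain ⟨h₁, h₂, h₄⟩ := QDS.isUnit_coordinates h𝒪 q₁ q₂ hq₁ hq₂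
  have h2 : IsUnit (2 : 𝒪) := QDS.isUnit_two_of_algebra (R := ℂ) (IsUnit.mk0 2 two_ne_zero)
  exact ⟨QDS.exists_basis_omega h2 h₁ h₂ h₄, QDS.toGaussManin_injective h2 h₁ h₂ h₄,
    QDS.omegaGM_eq_cov, QDS.exists_isQuantumDifferentialSystem h₁ h₂ h₄⟩
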